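/- \textbf{Definitions.} A $C^\infty$-ring is a set $A$ on which every smooth function $\mathbb R^n\to\mathbb R$ ($n\ge 0$) acts as an $n$-ary operation, compatibly with projections and composition; in particular $A$ is a commutative ring (an $\mathbb R$-algebra). It is \emph{finitely generated} if it is a quotient of some $C^\infty(\mathbb R^n)$, and \emph{local} if it has a unique maximal ideal $\mathfrak m$ and $A/\mathfrak m\cong\mathbb R$. For a simplicial $C^\infty$-ring $A_\bullet$, $\pi_0(A_\bullet)$ is the $C^\infty$-ring obtained as the quotient of $A_0$ by the congruence given by the two boundaries $A_1\to A_0$, and $\pi_k(A_\bullet)$ ($k\ge 1$) is the $k$-th homology of the complex $(A_n,\sum(-1)^i\partial_i)$. For a sheaf $\mathcal O_\bullet$ of simplicial $C^\infty$-rings, $\pi_k(\mathcal O_\bullet)$ is the sheaf associated to $U\mapsto\pi_k(\Gamma(U,\mathcal O_\bullet))$. A \emph{simplicial $C^\infty$-space} is a Hausdorff space $X$ with a sheaf $\mathcal O_{\bullet,X}$ of simplicial $C^\infty$-rings such that $\pi_0(\mathcal O_{\bullet,X})$ is a soft sheaf of finitely generated $C^\infty$-rings (its sections over every open set form a finitely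 generated $C^\infty$-ring, and sections over closed sets extend to $X$) with local stalks. A morphism $(X,\mathcal O_{\bullet,X})\to(Y,\mathcal O_{\bullet,Y})$ is a continuous map $\phi:X\to Y$ with a morphism $\phi^\sharp:\mathcal O_{\bullet,Y}\to\phi_*\mathcal O_{\bullet,X}$ of sheaves of simplicial $C^\infty$-rings. Let $s\mathbb G$ be the resulting category, and $\overline{s\mathbb G}\subset s\mathbb G$ the full subcategory of \emph{localized} objects, those for which the stalks of $\mathcal O_{0,X}$ are local $C^\infty$-rings. A morphism $(\phi,\phi^\sharp)$ in $s\mathbb G$ is a \emph{local weak equivalence} if $\phi$ is a homeomorphism and $\pi_k(\mathcal O_{\bullet,Y})\to\phi_*\pi_k(\mathcal O_{\bullet,X})$ is an isomorphism for all $k\ge 0$. For $(X,\mathcal O_{\bullet,X})\in s\mathbb G$ and $p\in X$ let $\mathfrak p$ be the composite $(\mathcal O_{0,X})_p\to\pi_0(\mathcal O_{\bullet,X})_p\to\mathbb R$ of the projection and the residue map. Let $\mathfrak t_p$ be the kernel of the map from $(\mathcal O_{0,X})_p$ to the $C^\infty$-ring obtained from it by universally inverting (among $C^\infty$-rings) every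 element on which $\mathfrak p$ is non-zero. A section $\alpha\in\Gamma(U,\mathcal O_{0,X})$ is \emph{trivial} if $\alpha_p\in\mathfrak t_p$ for all $p\in U$; the trivial sections form a sheaf of ideals $\mathfrak t\subset\mathcal O_{0,X}$. Let $\mathcal O_{\bullet,X}/\mathfrak t\,\mathcal O_{\bullet,X}$ be the sheaf associated to $U\mapsto\Gamma(U,\mathcal O_{\bullet,X})/\mathfrak t(U)\,\Gamma(U,\mathcal O_{\bullet,X})$, where $\Gamma(U,\mathcal O_{0,X})$ acts on $\Gamma(U,\mathcal O_{n,X})$ through the degeneracies. \textbf{Proposition.} The inclusion $\overline{s\mathbb G}\subset s\mathbb G$ has a right adjoint $R$. The unit of this adjunction is an isomorphism, and the components of the counit are local weak equivalences. Moreover, $R$ is given by dividing out the trivial sections: for every $(X,\mathcal O_{\bullet,X})\in s\mathbb G$, the underlying map of the counit $R(X,\mathcal O_{\bullet,X})\to(X,\mathcal O_{\bullet,X})$ is a homeomorphism and its sheaf component exhibits the structure sheaf of $R(X,\mathcal O_{\bullet,X})$ as the quotient sheaf $\mathcal O_{\bullet,X}/\mathfrak t\,\mathcal O_{\bullet,X}$.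 -/

import Mathlib

open CategoryTheory Opposite TopologicalSpace AlgebraicGeometry
open scoped ContDiff Simplicial

universe u v w

noncomputable section

/-! ## `C^∞`-rings -/

/-- `C^∞(ℝⁿ)`, the smooth functions `ℝⁿ → ℝ`. -/
abbrev SmoothFun (n : ℕ) : Type := {f : (Fin n → ℝ) → ℝ // ContDiff ℝ ∞ f}

namespace SmoothFun

/-- The coordinate function `x_i`. -/
def proj {n : ℕ} (i : Fin n) : SmoothFun n := ⟨fun x => x i, contDiff_apply ℝ ℝ i⟩

/-- The composite `f(g_1, …, g_m)`. -/
def comp {m n : ℕ} (f : SmoothFun m) (g : Fin m → SmoothFun n) : SmoothFun n :=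
  ⟨fun x => f.1 (fun i => (g i).1 x), f.2.comp (contDiff_pi.2 fun i => (g i).2)⟩

/-- A constant function. -/
def const {n : ℕ} (c : ℝ) : SmoothFun n := ⟨fun _ => c, contDiff_const⟩

/-- Addition `ℝ² → ℝ`. -/
def add : SmoothFun 2 := ⟨fun x => x 0 + x 1, (contDiff_apply ℝ ℝ 0).add (contDiff_apply ℝ ℝ 1)⟩

/-- Multiplication `ℝ² → ℝ`. -/
def mul : SmoothFun 2 := ⟨fun x => x 0 * x 1, (contDiff_apply ℝ ℝ 0).mul (contDiff_apply ℝ ℝ 1)⟩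

/-- Negation `ℝ → ℝ`. -/
def neg : SmoothFun 1 := ⟨fun x => - x 0, (contDiff_apply ℝ ℝ 0).neg⟩

end SmoothFun

/-- A `C^∞`-ring: a set `A` on which every smooth function `ℝⁿ → ℝ` acts as an `n`-ary operation,
compatibly with projections and composition. The ring operations are those given by the smooth
functions `x + y` and `x y` (the fields `op_add`, `op_mul` only say that the commutative ring
structure carried along is this one). -/
class CInftyRing (A : Type u) extends CommRing A where
  op : ∀ {n : ℕ}, SmoothFun n → (Fin n → A) → A
  op_proj : ∀ {n : ℕ} (i : Fin n) (a : Fin n → A), op (SmoothFun.proj i) a = a i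
  op_comp : ∀ {m n : ℕ} (f : SmoothFun m) (g : Fin m → SmoothFun n) (a : Fin n → A),
    op (SmoothFun.comp f g) a = op f (fun i => op (g i) a)
  op_add : ∀ a b : A, op SmoothFun.add ![a, b] = a + b
  op_mul : ∀ a b : A, op SmoothFun.mul ![a, b] = a * b

/-- The operations of a `C^∞`-ring without the redundant ring structure; see `CInftyRing.ofOps`. -/
structure CInftyOps (A : Type u) where
  op : ∀ {n : ℕ}, SmoothFun n → (Fin n → A) → A
  op_proj : ∀ {n : ℕ} (i : Fin n) (a : Fin n → A), op (SmoothFun.proj i) a = a i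
  op_comp : ∀ {m n : ℕ} (f : SmoothFun m) (g : Fin m → SmoothFun n) (a : Fin n → A),
    op (SmoothFun.comp f g) a = op f (fun i => op (g i) a)

namespace CInftyOps

variable {A : Type u} (c : CInftyOps A)

theorem op_one (F : SmoothFun 1) {n : ℕ} (f : SmoothFun n) (a : Fin n → A) :
    c.op F ![c.op f a] = c.op (SmoothFun.comp F ![f]) a := by
  rw [c.op_comp]; congr 1; funext i; fin_cases i; rfl

theorem op_two (F : SmoothFun 2) {n : ℕ} (f g : SmoothFun n) (a : Fin n → A) :
    c.op F ![c.op f a, c.op g a] = c.op (SmoothFun.comp F ![f, g]) a := by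
  rw [c.op_comp]; congr 1; funext i; fin_cases i <;> rfl

theorem op_const {n : ℕ} (r : ℝ) (a : Fin n → A) :
    c.op (SmoothFun.const r) ![] = c.op (SmoothFun.const r) a := by
  have h : (SmoothFun.const r : SmoothFun n) =
      SmoothFun.comp (SmoothFun.const r : SmoothFun 0) ![] := rfl
  rw [h, c.op_comp]; congr 1; funext i; exact i.elim0

theorem ind {P : A → A → A → Prop}
    (h : ∀ (v : Fin 3 → A) (f g k : SmoothFun 3), P (c.op f v) (c.op g v) (c.op k v))
    (a b d : A) : P a b d := by
  have := h ![a, b, d] (SmoothFun.proj 0) (SmoothFun.proj 1) (SmoothFun.proj 2)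
  rw [c.op_proj, c.op_proj, c.op_proj] at this
  exact this

/-- The commutative ring structure underlying a `C^∞`-ring. -/
@[reducible] def toCommRing : CommRing A :=
  letI : Add A := ⟨fun a b => c.op SmoothFun.add ![a, b]⟩
  letI : Mul A := ⟨fun a b => c.op SmoothFun.mul ![a, b]⟩
  letI : Neg A := ⟨fun a => c.op SmoothFun.neg ![a]⟩
  letI : Zero A := ⟨c.op (SmoothFun.const 0) ![]⟩
  letI : One A := ⟨c.op (SmoothFun.const 1) ![]⟩
  have ha : ∀ {n : ℕ} (f g : SmoothFun n) (v : Fin n → A),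
      c.op f v + c.op g v = c.op (SmoothFun.comp SmoothFun.add ![f, g]) v :=
    fun f g v => c.op_two _ f g v
  have hm : ∀ {n : ℕ} (f g : SmoothFun n) (v : Fin n → A),
      c.op f v * c.op g v = c.op (SmoothFun.comp SmoothFun.mul ![f, g]) v :=
    fun f g v => c.op_two _ f g v
  have hn : ∀ {n : ℕ} (f : SmoothFun n) (v : Fin n → A),
      - c.op f v = c.op (SmoothFun.comp SmoothFun.neg ![f]) v := fun f v => c.op_one _ f v
  have h0 : ∀ {n : ℕ} (v : Fin n → A), (0 : A) = c.op (SmoothFun.const 0) v :=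
    fun v => c.op_const 0 v
  have h1 : ∀ {n : ℕ} (v : Fin n → A), (1 : A) = c.op (SmoothFun.const 1) v :=
    fun v => c.op_const 1 v
  have e : ∀ {n : ℕ} {f g : SmoothFun n} (v : Fin n → A), (∀ x, f.1 x = g.1 x) →
      c.op f v = c.op g v := fun v h => by rw [Subtype.ext (funext h)]
  { add_assoc := c.ind fun v f g k => by
      simp only [ha]
      exact e v fun x => add_assoc (f.1 x) (g.1 x) (k.1 x)
    zero_add := fun a => c.ind (P := fun a _ _ => 0 + a = a) (fun v f _ _ => by
      rw [h0 v, ha]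
      exact e v fun x => zero_add (f.1 x)) a a a
    add_zero := fun a => c.ind (P := fun a _ _ => a + 0 = a) (fun v f _ _ => by
      rw [h0 v, ha]
      exact e v fun x => add_zero (f.1 x)) a a a
    add_comm := fun a b => c.ind (P := fun a b _ => a + b = b + a) (fun v f g _ => by
      simp only [ha]
      exact e v fun x => add_comm (f.1 x) (g.1 x)) a b b
    left_distrib := c.ind fun v f g k => by
      simp only [ha, hm]
      exact e v fun x => mul_add (f.1 x) (g.1 x) (k.1 x)
    right_distrib := c.ind fun v f g k => by
      simp only [ha, hm]
      exact e v fun x => add_mul (f.1 x) (g.1 x) (k.1 x)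
    zero_mul := fun a => c.ind (P := fun a _ _ => 0 * a = 0) (fun v f _ _ => by
      rw [h0 v, hm]
      exact e v fun x => zero_mul (f.1 x)) a a a
    mul_zero := fun a => c.ind (P := fun a _ _ => a * 0 = 0) (fun v f _ _ => by
      rw [h0 v, hm]
      exact e v fun x => mul_zero (f.1 x)) a a a
    mul_assoc := c.ind fun v f g k => by
      simp only [hm]
      exact e v fun x => mul_assoc (f.1 x) (g.1 x) (k.1 x)
    one_mul := fun a => c.ind (P := fun a _ _ => 1 * a = a) (fun v f _ _ => by
      rw [h1 v, hm]
      exact e v fun x => one_mul (f.1 x)) a a a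
    mul_one := fun a => c.ind (P := fun a _ _ => a * 1 = a) (fun v f _ _ => by
      rw [h1 v, hm]
      exact e v fun x => mul_one (f.1 x)) a a a
    neg_add_cancel := fun a => c.ind (P := fun a _ _ => -a + a = 0) (fun v f _ _ => by
      rw [h0 v, hn, ha]
      exact e v fun x => neg_add_cancel (f.1 x)) a a a
    mul_comm := fun a b => c.ind (P := fun a b _ => a * b = b * a) (fun v f g _ => by
      simp only [hm]
      exact e v fun x => mul_comm (f.1 x) (g.1 x)) a b b
    nsmul := nsmulRec
    zsmul := zsmulRec }

end CInftyOps

/-- Operations satisfying the projection and composition laws make a set into a `C^∞`-ring. -/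
@[reducible] def CInftyRing.ofOps {A : Type u} (c : CInftyOps A) : CInftyRing A :=
  letI := c.toCommRing
  { op := c.op
    op_proj := c.op_proj
    op_comp := c.op_comp
    op_add := fun _ _ => rfl
    op_mul := fun _ _ => rfl }

/-- `ℝ` is a `C^∞`-ring, by evaluation of smooth functions. -/
instance : CInftyRing ℝ where
  op f a := f.1 a
  op_proj _ _ := rfl
  op_comp _ _ _ := rfl
  op_add _ _ := rfl
  op_mul _ _ := rfl

/-- A morphism of `C^∞`-rings: a map commuting with all operations. -/
@[ext] structure CInftyHom (A : Type u) (B : Type v) [CInftyRing A] [CInftyRing B] where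
  toFun : A → B
  map_op : ∀ {n : ℕ} (f : SmoothFun n) (a : Fin n → A),
    toFun (CInftyRing.op f a) = CInftyRing.op f (fun i => toFun (a i))

namespace CInftyHom

variable {A : Type u} {B : Type v} {D : Type w} [CInftyRing A] [CInftyRing B] [CInftyRing D]

instance : FunLike (CInftyHom A B) A B where
  coe := toFun
  coe_injective := fun f g h => by cases f; cases g; congr

/-- The identity. -/
def id (A : Type u) [CInftyRing A] : CInftyHom A A := ⟨fun a => a, fun _ _ => rfl⟩

/-- Composition. -/
def comp (g : CInftyHom B D) (f : CInftyHom A B) : CInftyHom A D :=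
  ⟨fun a => g (f a), fun k a => by
    change g.toFun (f.toFun _) = _
    rw [f.map_op, g.map_op]; rfl⟩

theorem map_add (φ : CInftyHom A B) (a b : A) : φ (a + b) = φ a + φ b := by
  rw [← CInftyRing.op_add, ← CInftyRing.op_add]
  refine (φ.map_op _ _).trans ?_
  congr 1; funext i; fin_cases i <;> rfl

theorem map_mul (φ : CInftyHom A B) (a b : A) : φ (a * b) = φ a * φ b := by
  rw [← CInftyRing.op_mul, ← CInftyRing.op_mul]
  refine (φ.map_op _ _).trans ?_
  congr 1; funext i; fin_cases i <;> rfl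

theorem op_one (A : Type u) [CInftyRing A] :
    (CInftyRing.op (SmoothFun.const 1 : SmoothFun 0) ![] : A) = 1 := by
  have h : ∀ a : A, (CInftyRing.op (SmoothFun.const 1 : SmoothFun 0) ![] : A) * a = a := by
    intro a
    have h1 : SmoothFun.comp SmoothFun.mul
        ![SmoothFun.comp (SmoothFun.const 1 : SmoothFun 0) ![], SmoothFun.proj 0] =
        (SmoothFun.proj 0 : SmoothFun 1) := Subtype.ext (funext fun x => one_mul (x 0))
    have h2 := CInftyRing.op_comp SmoothFun.mul
        ![SmoothFun.comp (SmoothFun.const 1 : SmoothFun 0) ![], SmoothFun.proj 0] ![a]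
    rw [h1, CInftyRing.op_proj] at h2
    refine Eq.trans ?_ h2.symm
    rw [← CInftyRing.op_mul]
    congr 1; funext i; fin_cases i
    · change _ = CInftyRing.op (SmoothFun.comp (SmoothFun.const 1 : SmoothFun 0) ![]) ![a]
      rw [CInftyRing.op_comp]
      change CInftyRing.op _ _ = _
      congr 1; funext i; exact i.elim0
    · exact (CInftyRing.op_proj 0 ![a]).symm
  simpa using h 1

theorem map_one (φ : CInftyHom A B) : φ 1 = 1 := by
  rw [← op_one A, ← op_one B]
  refine (φ.map_op _ _).trans ?_
  congr 1; funext i; exact i.elim0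

/-- The ring homomorphism underlying a morphism of `C^∞`-rings. -/
def toRingHom (φ : CInftyHom A B) : A →+* B :=
  RingHom.mk' ⟨⟨φ, φ.map_one⟩, φ.map_mul⟩ φ.map_add

end CInftyHom

/-- A `C^∞`-ring is finitely generated if it is a quotient of some `C^∞(ℝⁿ)`. A morphism
`C^∞(ℝⁿ) → A` is the same as a tuple `a` in `Aⁿ`, and sends `f` to `f(a)`. -/
def CInftyRing.FinGen (A : Type u) [CInftyRing A] : Prop :=
  ∃ (n : ℕ) (a : Fin n → A), Function.Surjective fun f : SmoothFun n => CInftyRing.op f a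

/-- A `C^∞`-ring `A` is local if it has a unique maximal ideal `𝔪` and `A/𝔪 ≅ ℝ`, i.e. `𝔪` is the
kernel of a surjection onto `ℝ`. -/
def CInftyRing.IsLocal (A : Type u) [CInftyRing A] : Prop :=
  ∃ _ : IsLocalRing A, ∃ φ : CInftyHom A ℝ,
    Function.Surjective φ ∧ RingHom.ker φ.toRingHom = IsLocalRing.maximalIdeal A

/-- The residue map `A → A/𝔪 ≅ ℝ` of a local `C^∞`-ring. -/
def CInftyRing.IsLocal.residue {A : Type u} [CInftyRing A] (h : CInftyRing.IsLocal A) :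
    CInftyHom A ℝ :=
  h.choose_spec.choose

/-- `ℓ : A → B` is obtained by universally inverting, among `C^∞`-rings, the elements of `S`. -/
structure IsCInftyLocalization {A B : Type u} [CInftyRing A] [CInftyRing B] (S : Set A)
    (ℓ : CInftyHom A B) : Prop where
  isUnit : ∀ s ∈ S, IsUnit (ℓ s)
  lift : ∀ (D : Type u) [CInftyRing D] (g : CInftyHom A D), (∀ s ∈ S, IsUnit (g s)) →
    ∃! h : CInftyHom B D, h.comp ℓ = g

/-- The category of `C^∞`-rings. -/
structure CInftyRingCat : Type (u + 1) where
  carrier : Type u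
  [str : CInftyRing carrier]

namespace CInftyRingCat

attribute [instance] CInftyRingCat.str

instance : CoeSort CInftyRingCat.{u} (Type u) := ⟨CInftyRingCat.carrier⟩

instance : Category CInftyRingCat.{u} where
  Hom A B := CInftyHom A B
  id A := CInftyHom.id A
  comp f g := CInftyHom.comp g f

instance : ConcreteCategory CInftyRingCat.{u} (fun A B => CInftyHom A B) where
  hom f := f
  ofHom f := f

/-- The underlying additive group. -/
def toAddCommGrp : CInftyRingCat.{u} ⥤ AddCommGrpCat.{u} where
  obj A := AddCommGrpCat.of A
  map f := AddCommGrpCat.ofHom (CInftyHom.toRingHom f).toAddMonoidHom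

end CInftyRingCat

/-! ## Simplicial `C^∞`-rings and their homotopy groups -/

/-- Simplicial `C^∞`-rings. -/
abbrev SCInftyRing : Type (u + 1) := SimplicialObject CInftyRingCat.{u}

namespace SCInftyRing

/-- The functor `A_• ↦ A_n`. -/
def level (n : ℕ) : SCInftyRing.{u} ⥤ CInftyRingCat.{u} :=
  (evaluation SimplexCategoryᵒᵖ CInftyRingCat.{u}).obj (op ⦋n⦌)

theorem δ_σ (A : SCInftyRing.{u}) (a : A _⦋0⦌) :
    A.δ 0 (A.σ 0 a) = a ∧ A.δ 1 (A.σ 0 a) = a := by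
  constructor
  · rw [← ConcreteCategory.comp_apply]
    exact ConcreteCategory.congr_hom (A.δ_comp_σ_self (i := 0)) a
  · rw [← ConcreteCategory.comp_apply]
    exact ConcreteCategory.congr_hom (A.δ_comp_σ_succ (i := 0)) a

/-- The congruence on `A_0` defined by the two boundaries `A_1 → A_0`. -/
def congr (A : SCInftyRing.{u}) : Setoid (A _⦋0⦌) where
  r a b := ∃ z : A _⦋1⦌, A.δ 0 z = a ∧ A.δ 1 z = b
  iseqv := by
    have hadd : ∀ (i : Fin 2) (x y : A _⦋1⦌), A.δ i (x + y) = A.δ i x + A.δ i y :=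
      fun i x y => CInftyHom.map_add _ x y
    have hsub : ∀ (i : Fin 2) (x y : A _⦋1⦌), A.δ i (x - y) = A.δ i x - A.δ i y :=
      fun i x y => (CInftyHom.toRingHom (A.δ i)).map_sub x y
    refine ⟨fun a => ⟨A.σ 0 a, A.δ_σ a⟩, ?_, ?_⟩
    · rintro a b ⟨z, h0, h1⟩
      refine ⟨A.σ 0 a + A.σ 0 b - z, ?_, ?_⟩
      · rw [hsub, hadd, (A.δ_σ a).1, (A.δ_σ b).1, h0]; ring
      · rw [hsub, hadd, (A.δ_σ a).2, (A.δ_σ b).2, h1]; ring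
    · rintro a b d ⟨z, h0, h1⟩ ⟨z', h0', h1'⟩
      refine ⟨z + z' - A.σ 0 b, ?_, ?_⟩
      · rw [hsub, hadd, (A.δ_σ b).1, h0, h0']; ring
      · rw [hsub, hadd, (A.δ_σ b).2, h1, h1']; ring

/-- `π_0(A_•)`, the quotient of `A_0` by the congruence defined by the two boundaries. -/
def PiZero (A : SCInftyRing.{u}) : Type u := Quotient A.congr

/-- The projection `A_0 → π_0(A_•)`. -/
def PiZero.mk (A : SCInftyRing.{u}) (a : A _⦋0⦌) : A.PiZero := Quotient.mk A.congr a

/-- The operations on `π_0(A_•)`, computed on representatives. -/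
def PiZero.op (A : SCInftyRing.{u}) {n : ℕ} (f : SmoothFun n) (a : Fin n → A.PiZero) : A.PiZero :=
  PiZero.mk A (CInftyRing.op f fun i => (a i).out)

theorem PiZero.op_mk (A : SCInftyRing.{u}) {n : ℕ} (f : SmoothFun n) (a : Fin n → A _⦋0⦌) :
    PiZero.op A f (fun i => PiZero.mk A (a i)) = PiZero.mk A (CInftyRing.op f a) := by
  have h : ∀ i, ∃ z : A _⦋1⦌, A.δ 0 z = (PiZero.mk A (a i)).out ∧ A.δ 1 z = a i :=
    fun i => Quotient.exact (s := A.congr) (Quotient.out_eq _)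
  choose z hz0 hz1 using h
  refine Quotient.sound (s := A.congr) ⟨CInftyRing.op f z, ?_, ?_⟩
  · refine (CInftyHom.map_op (A.δ 0) f z).trans ?_
    congr 1; exact funext hz0
  · refine (CInftyHom.map_op (A.δ 1) f z).trans ?_
    congr 1; exact funext hz1

theorem PiZero.mk_surjective (A : SCInftyRing.{u}) : Function.Surjective (PiZero.mk A) :=
  Quotient.mk_surjective

instance (A : SCInftyRing.{u}) : CInftyRing A.PiZero := CInftyRing.ofOps
  { op := fun f a => PiZero.op A f a
    op_proj := fun i a => by
      choose b hb using fun i => PiZero.mk_surjective A (a i)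
      obtain rfl : a = fun i => PiZero.mk A (b i) := funext fun i => (hb i).symm
      rw [PiZero.op_mk, CInftyRing.op_proj]
    op_comp := fun f g a => by
      choose b hb using fun i => PiZero.mk_surjective A (a i)
      obtain rfl : a = fun i => PiZero.mk A (b i) := funext fun i => (hb i).symm
      simp only [PiZero.op_mk, CInftyRing.op_comp] }

/-- The functor `A_• ↦ π_0(A_•)`. -/
def piZero : SCInftyRing.{u} ⥤ CInftyRingCat.{u} where
  obj A := ⟨A.PiZero⟩
  map {A B} φ :=
    { toFun := Quotient.map (sa := A.congr) (sb := B.congr) (φ.app (op ⦋0⦌)) (by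
        rintro a b ⟨z, rfl, rfl⟩
        refine ⟨φ.app (op ⦋1⦌) z, ?_, ?_⟩
        · rw [← ConcreteCategory.comp_apply, ← ConcreteCategory.comp_apply]
          exact (ConcreteCategory.congr_hom (φ.naturality (SimplexCategory.δ 0).op) z).symm
        · rw [← ConcreteCategory.comp_apply, ← ConcreteCategory.comp_apply]
          exact (ConcreteCategory.congr_hom (φ.naturality (SimplexCategory.δ 1).op) z).symm)
      map_op := fun f a => by
        choose b hb using fun i => PiZero.mk_surjective A (a i)
        obtain rfl : a = fun i => PiZero.mk A (b i) := funext fun i => (hb i).symm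
        have h1 : CInftyRing.op f (fun i => PiZero.mk A (b i)) =
          PiZero.mk A (CInftyRing.op f b) := PiZero.op_mk A f b
        rw [h1]
        refine Eq.trans ?_ (PiZero.op_mk B f fun i => φ.app (op ⦋0⦌) (b i)).symm
        exact congrArg (PiZero.mk B) (CInftyHom.map_op (φ.app (op ⦋0⦌)) f b) }
  map_id A := CInftyHom.ext (funext fun a => by
    obtain ⟨b, rfl⟩ := PiZero.mk_surjective A a; rfl)
  map_comp f g := CInftyHom.ext (funext fun a => by
    obtain ⟨b, rfl⟩ := PiZero.mk_surjective _ a; rfl)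

/-- The natural projection `A_0 → π_0(A_•)`. -/
def toPiZero : level.{u} 0 ⟶ piZero where
  app A := { toFun := PiZero.mk A, map_op := fun f a => (PiZero.op_mk A f a).symm }

/-- The functor `A_• ↦ π_k(A_•)`, the `k`-th homology of the Moore complex of `A_•`. -/
def homotopyGroup (k : ℕ) : SCInftyRing.{u} ⥤ AddCommGrpCat.{u} :=
  (SimplicialObject.whiskering _ _).obj CInftyRingCat.toAddCommGrp ⋙
    AlgebraicTopology.alternatingFaceMapComplex AddCommGrpCat.{u} ⋙
    HomologicalComplex.homologyFunctor AddCommGrpCat.{u} _ k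

/-- The map `A_0 → A_n` given by degeneracies. -/
def degeneracy (n : ℕ) (A : SCInftyRing.{u}) : CInftyHom (A _⦋0⦌) (A _⦋n⦌) :=
  A.map (SimplexCategory.const ⦋n⦌ ⦋0⦌ 0).op

end SCInftyRing

/-! ## Presheaves, stalks and associated sheaves -/

namespace TopCat.Presheaf

variable {X : TopCat.{u}}

/-- The sections over a subset `Z` of the sheaf associated to a presheaf of sets `P` (for `Z` not
open, of the inverse image of this sheaf on `Z`): families of germs that are locally on `Z` given
by sections of `P`. -/
@[ext] structure Sections (P : X.Presheaf (Type u)) (Z : Set X) : Type u where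
  val : ∀ z : Z, P.stalk z.1
  locallyGerm : ∀ z : Z, ∃ (V : Opens X) (_ : z.1 ∈ V) (t : P.obj (op V)),
    ∀ (w : Z) (hw : w.1 ∈ V), val w = P.germ V w.1 hw t

/-- Restriction of sections of the associated sheaf. -/
def Sections.restrict {P : X.Presheaf (Type u)} {Z W : Set X} (h : W ⊆ Z) (s : P.Sections Z) :
    P.Sections W :=
  ⟨fun w => s.val ⟨w.1, h w.2⟩, fun w => by
    obtain ⟨V, hV, t, ht⟩ := s.locallyGerm ⟨w.1, h w.2⟩
    exact ⟨V, hV, t, fun w' hw' => ht ⟨w'.1, h w'.2⟩ hw'⟩⟩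

/-- The underlying presheaf of sets of a presheaf of `C^∞`-rings. -/
abbrev sets (F : X.Presheaf CInftyRingCat.{u}) : X.Presheaf (Type u) := F ⋙ forget CInftyRingCat.{u}

/-- The stalk of a presheaf of `C^∞`-rings. -/
def CStalk (F : X.Presheaf CInftyRingCat.{u}) (x : X) : Type u := F.sets.stalk x

/-- The germ of a section. -/
def cgerm (F : X.Presheaf CInftyRingCat.{u}) (U : Opens X) (x : X) (hx : x ∈ U)
    (s : F.obj (op U)) : F.CStalk x :=
  F.sets.germ U x hx s

theorem cgerm_res (F : X.Presheaf CInftyRingCat.{u}) {U V : Opens X} (i : U ⟶ V) (x : X)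
    (hx : x ∈ U) (s : F.obj (op V)) :
    F.cgerm U x hx (F.map i.op s) = F.cgerm V x (i.le hx) s :=
  germ_res_apply F.sets i x hx s

theorem map_cop (F : X.Presheaf CInftyRingCat.{u}) {U V : (Opens X)ᵒᵖ} (i : U ⟶ V) {n : ℕ}
    (f : SmoothFun n) (s : Fin n → F.obj U) :
    F.map i (CInftyRing.op f s) = CInftyRing.op f fun j => F.map i (s j) :=
  CInftyHom.map_op (F.map i) f s

theorem exists_cgerm (F : X.Presheaf CInftyRingCat.{u}) (x : X) {n : ℕ} (a : Fin n → F.CStalk x) :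
    ∃ (U : Opens X) (hx : x ∈ U) (s : Fin n → F.obj (op U)),
      a = fun i => F.cgerm U x hx (s i) := by
  have h : ∀ i, ∃ (U : Opens X) (hx : x ∈ U) (s : F.obj (op U)), F.cgerm U x hx s = a i := by
    intro i
    obtain ⟨U, hx, s, hs⟩ := exists_germ_eq F.sets (x := x) (a i)
    exact ⟨U, hx, s, hs⟩
  choose U hx s hs using h
  let W : Opens X := ⟨⋂ i, (U i : Set X), isOpen_iInter_of_finite fun i => (U i).isOpen⟩
  have hW : ∀ i, W ≤ U i := fun i => Set.iInter_subset (fun i => (U i : Set X)) i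
  refine ⟨W, Set.mem_iInter.2 hx, fun i => F.map (homOfLE (hW i)).op (s i), funext fun i => ?_⟩
  rw [cgerm_res, hs]

theorem cgerm_op_eq (F : X.Presheaf CInftyRingCat.{u}) (x : X) {n : ℕ} (f : SmoothFun n)
    {U V : Opens X} (hU : x ∈ U) (hV : x ∈ V) (s : Fin n → F.obj (op U)) (t : Fin n → F.obj (op V))
    (h : ∀ i, F.cgerm U x hU (s i) = F.cgerm V x hV (t i)) :
    F.cgerm U x hU (CInftyRing.op f s) = F.cgerm V x hV (CInftyRing.op f t) := by
  have h' : ∀ i, ∃ (W : Opens X) (_ : x ∈ W) (iU : W ⟶ U) (iV : W ⟶ V),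
      F.map iU.op (s i) = F.map iV.op (t i) := fun i => germ_eq F.sets x hU hV (s i) (t i) (h i)
  choose W hW iU iV hst using h'
  let W' : Opens X := ⟨U ∩ V ∩ ⋂ i, (W i : Set X),
    (U.isOpen.inter V.isOpen).inter (isOpen_iInter_of_finite fun i => (W i).isOpen)⟩
  have hW' : ∀ i, W' ≤ W i := fun i =>
    Set.inter_subset_right.trans (Set.iInter_subset (fun i => (W i : Set X)) i)
  have hx : x ∈ W' := ⟨⟨hU, hV⟩, Set.mem_iInter.2 hW⟩
  have jU : W' ⟶ U := homOfLE fun y hy => hy.1.1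
  have jV : W' ⟶ V := homOfLE fun y hy => hy.1.2
  rw [← F.cgerm_res jU x hx, ← F.cgerm_res jV x hx, map_cop, map_cop]
  congr 2
  funext i
  have e1 : jU = homOfLE (hW' i) ≫ iU i := Subsingleton.elim _ _
  have e2 : jV = homOfLE (hW' i) ≫ iV i := Subsingleton.elim _ _
  rw [e1, e2, op_comp, op_comp, F.map_comp, F.map_comp, ConcreteCategory.comp_apply,
    ConcreteCategory.comp_apply, hst]

/-- The operations on a stalk: represent the germs by sections over a common neighbourhood. -/
def cstalkOp (F : X.Presheaf CInftyRingCat.{u}) (x : X) {n : ℕ} (f : SmoothFun n)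
    (a : Fin n → F.CStalk x) : F.CStalk x :=
  F.cgerm (F.exists_cgerm x a).choose x (F.exists_cgerm x a).choose_spec.choose
    (CInftyRing.op f (F.exists_cgerm x a).choose_spec.choose_spec.choose)

theorem cstalkOp_cgerm (F : X.Presheaf CInftyRingCat.{u}) (x : X) {n : ℕ} (f : SmoothFun n)
    {U : Opens X} (hU : x ∈ U) (s : Fin n → F.obj (op U)) :
    F.cstalkOp x f (fun i => F.cgerm U x hU (s i)) = F.cgerm U x hU (CInftyRing.op f s) := by
  have h := (F.exists_cgerm x (fun i => F.cgerm U x hU (s i))).choose_spec.choose_spec.choose_spec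
  exact F.cgerm_op_eq x f _ _ _ _ fun i => (congrFun h i).symm

instance (F : X.Presheaf CInftyRingCat.{u}) (x : X) : CInftyRing (F.CStalk x) := CInftyRing.ofOps
  { op := fun f a => F.cstalkOp x f a
    op_proj := fun i a => by
      obtain ⟨U, hx, s, rfl⟩ := F.exists_cgerm x a
      rw [cstalkOp_cgerm, CInftyRing.op_proj]
    op_comp := fun f g a => by
      obtain ⟨U, hx, s, rfl⟩ := F.exists_cgerm x a
      simp only [cstalkOp_cgerm, CInftyRing.op_comp] }

/-- The sheaf associated to a presheaf of `C^∞`-rings is a sheaf of `C^∞`-rings, with operations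
computed stalkwise. -/
instance (F : X.Presheaf CInftyRingCat.{u}) (Z : Set X) : CInftyRing (F.sets.Sections Z) :=
  CInftyRing.ofOps
  { op := fun {n} f a => ⟨fun z => (CInftyRing.op f fun i => ((a i).val z : F.CStalk z.1) :
        F.CStalk z.1), fun z => by
      choose V hV t ht using fun i => (a i).locallyGerm z
      let W : Opens X := ⟨⋂ i, (V i : Set X), isOpen_iInter_of_finite fun i => (V i).isOpen⟩
      have hW : ∀ i, W ≤ V i := fun i => Set.iInter_subset (fun i => (V i : Set X)) i
      let t' : Fin n → F.obj (op W) := fun i => F.map (homOfLE (hW i)).op (t i)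
      refine ⟨W, Set.mem_iInter.2 hV, (CInftyRing.op f t' : F.obj (op W)), fun w hw => ?_⟩
      refine Eq.trans ?_ (F.cstalkOp_cgerm w.1 f hw t')
      change F.cstalkOp w.1 f _ = _
      congr 1
      funext i
      exact (ht i w (hW i hw)).trans (F.cgerm_res (homOfLE (hW i)) w.1 hw (t i)).symm⟩
    op_proj := fun i a => Sections.ext (funext fun z => CInftyRing.op_proj (A := F.CStalk z.1) _ _)
    op_comp := fun f g a => Sections.ext (funext fun z =>
      CInftyRing.op_comp (A := F.CStalk z.1) _ _ _) }

end TopCat.Presheaf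

/-- The map induced by a morphism `g : P ⟶ Q` of spaces with presheaves of sets from the associated
sheaf of `Q.presheaf` to the direct image of the associated sheaf of `P.presheaf`. -/
def AlgebraicGeometry.PresheafedSpace.Hom.sectionsMap {P Q : PresheafedSpace.{u} (Type u)}
    (g : P.Hom Q) (Z : Set Q) (s : Q.presheaf.Sections Z) :
    P.presheaf.Sections (g.base ⁻¹' Z) :=
  ⟨fun z => g.stalkMap z.1 (s.val ⟨g.base z.1, z.2⟩), fun z => by
    obtain ⟨V, hV, t, ht⟩ := s.locallyGerm ⟨g.base z.1, z.2⟩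
    refine ⟨(Opens.map g.base).obj V, hV, g.c.app (op V) t, fun w hw => ?_⟩
    refine (congrArg (g.stalkMap w.1) (ht ⟨g.base w.1, w.2⟩ hw)).trans ?_
    exact PresheafedSpace.stalkMap_germ_apply g V w.1 hw t⟩

/-! ## Simplicial `C^∞`-spaces -/

/-- For a topological space `X` and a presheaf `F` of `C^∞`-rings on it with associated sheaf
`F⁺`, the pair `(X, F⁺)` is a `C^∞`-space: `X` is Hausdorff, `F⁺` is a soft sheaf of finitely
generated `C^∞`-rings, and its stalks (which are those of `F`) are local `C^∞`-rings. -/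
structure IsCInftySpace {X : TopCat.{u}} (F : X.Presheaf CInftyRingCat.{u}) : Prop where
  t2 : T2Space X
  soft : ∀ Z : Set X, IsClosed Z → Function.Surjective
    (TopCat.Presheaf.Sections.restrict (P := F.sets) (Set.subset_univ Z))
  finGen : ∀ U : Opens X, CInftyRing.FinGen (F.sets.Sections (U : Set X))
  isLocal : ∀ x : X, CInftyRing.IsLocal (F.CStalk x)

/-- The presheaf `O_n`. -/
abbrev levelPresheaf (n : ℕ) (X : PresheafedSpace.{u} SCInftyRing.{u}) :
    TopCat.Presheaf CInftyRingCat.{u} X.carrier :=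
  X.presheaf ⋙ SCInftyRing.level n

/-- The presheaf `U ↦ π_0(Γ(U, O_•))`. -/
abbrev piZeroPresheaf (X : PresheafedSpace.{u} SCInftyRing.{u}) :
    TopCat.Presheaf CInftyRingCat.{u} X.carrier :=
  X.presheaf ⋙ SCInftyRing.piZero

/-- A simplicial `C^∞`-space is a topological space `X` with a sheaf `O_•` of simplicial
`C^∞`-rings such that `(X, π_0(O_•))` is a `C^∞`-space. -/
structure IsSimplicialCInftySpace (X : PresheafedSpace.{u} SCInftyRing.{u}) : Prop where
  isSheaf : ∀ n, (levelPresheaf n X).sets.IsSheaf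
  isCInftySpace : IsCInftySpace (piZeroPresheaf X)

/-- The category of simplicial `C^∞`-spaces. A morphism `X ⟶ Y` is a continuous map `φ` together
with a morphism `O_{•,Y} ⟶ φ_* O_{•,X}` of sheaves of simplicial `C^∞`-rings. -/
abbrev SCInftySpace : Type (u + 1) :=
  ObjectProperty.FullSubcategory
    (IsSimplicialCInftySpace : ObjectProperty (PresheafedSpace.{u} SCInftyRing.{u}))

/-- `X` is localized if the stalks of `O_0` are local `C^∞`-rings. -/
def isLocalized : ObjectProperty SCInftySpace.{u} := fun X =>
  ∀ x : X.obj, CInftyRing.IsLocal ((levelPresheaf 0 X.obj).CStalk x)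

/-- The full subcategory of localized simplicial `C^∞`-spaces. -/
abbrev LocalizedSCInftySpace : Type (u + 1) := isLocalized.{u}.FullSubcategory

/-- The map on associated sheaves over `Z` induced by a morphism of simplicial `C^∞`-spaces, for
the presheaves obtained by applying a functor `Φ` to the structure sheaves. -/
def sheafMap (Φ : SCInftyRing.{u} ⥤ Type u) {X Y : SCInftySpace.{u}} (f : X ⟶ Y)
    (Z : Set Y.obj) : TopCat.Presheaf.Sections (Y.obj.presheaf ⋙ Φ) Z →
      TopCat.Presheaf.Sections (X.obj.presheaf ⋙ Φ) (f.hom.base ⁻¹' Z) :=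
  PresheafedSpace.Hom.sectionsMap (Φ.mapPresheaf.map f.hom) Z

/-- A morphism `(φ, φ^♯)` is a local weak equivalence if it induces an isomorphism of the
`C^∞`-spaces `(X, π_0(O_•))` and isomorphisms `π_k(O_{•,Y}) → φ_* π_k(O_{•,X})` for all `k ≥ 1`. -/
structure IsLocalWeakEquivalence {X Y : SCInftySpace.{u}} (f : X ⟶ Y) : Prop where
  isHomeomorph : IsHomeomorph f.hom.base
  piZero : ∀ V : Opens Y.obj, Function.Bijective
    (sheafMap (SCInftyRing.piZero ⋙ forget CInftyRingCat.{u}) f (V : Set Y.obj))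
  homotopyGroup : ∀ k : ℕ, 1 ≤ k → ∀ V : Opens Y.obj, Function.Bijective
    (sheafMap (SCInftyRing.homotopyGroup k ⋙ forget AddCommGrpCat.{u}) f (V : Set Y.obj))

/-! ## Trivial sections -/

namespace SCInftySpace

/-- The value `𝔭(a)` at `p` of a germ `a` in `(O_0)_p`: its image under
`(O_0)_p → π_0(O_•)_p → ℝ`. -/
def value (X : SCInftySpace.{u}) (p : X.obj) (a : (levelPresheaf 0 X.obj).CStalk p) : ℝ :=
  (X.property.isCInftySpace.isLocal p).residue
    ((TopCat.Presheaf.stalkFunctor (Type u) p).map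
      (Functor.whiskerRight (Functor.whiskerLeft X.obj.presheaf SCInftyRing.toPiZero)
        (forget CInftyRingCat.{u})) a)

/-- `𝔱_p`: the germs in the kernel of the localization of `(O_0)_p` at `𝔭`. -/
def IsTrivialGerm (X : SCInftySpace.{u}) (p : X.obj)
    (a : (levelPresheaf 0 X.obj).CStalk p) : Prop :=
  ∃ (B : Type u) (_ : CInftyRing B) (ℓ : CInftyHom ((levelPresheaf 0 X.obj).CStalk p) B),
    IsCInftyLocalization {g | X.value p g ≠ 0} ℓ ∧ ℓ a = 0

/-- The trivial sections of `O_0` over `U`. -/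
def trivialSections (X : SCInftySpace.{u}) (U : Opens X.obj) :
    Set ((levelPresheaf 0 X.obj).obj (op U)) :=
  {α | ∀ (p : X.obj) (hp : p ∈ U), X.IsTrivialGerm p ((levelPresheaf 0 X.obj).cgerm U p hp α)}

/-- The ideal of `Γ(U, O_n)` generated by the trivial sections of `O_0` over `U`. -/
def trivialIdeal (X : SCInftySpace.{u}) (n : ℕ) (U : Opens X.obj) :
    Ideal ((levelPresheaf n X.obj).obj (op U)) :=
  Ideal.span (SCInftyRing.degeneracy n (X.obj.presheaf.obj (op U)) '' X.trivialSections U)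

end SCInftySpace

/-- `(φ, φ^♯) : Y ⟶ X` exhibits `Y` as `(X, O_• / 𝔱 O_•)`, where `𝔱` is the sheaf of trivial
sections: `φ` is a homeomorphism and each `O_{n,X} → φ_* O_{n,Y}` is an epimorphism of sheaves
whose kernel is the sheaf of ideals associated to `U ↦ 𝔱(U) Γ(U, O_{n,X})`. -/
structure IsQuotientByTrivialSections {X Y : SCInftySpace.{u}} (f : Y ⟶ X) : Prop where
  isHomeomorph : IsHomeomorph f.hom.base
  locallySurjective : ∀ (n : ℕ) (U : Opens X.obj)
    (t : (levelPresheaf n Y.obj).obj (op ((Opens.map f.hom.base).obj U))),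
    ∀ x ∈ U, ∃ (V : Opens X.obj) (i : V ⟶ U) (_ : x ∈ V) (s : (levelPresheaf n X.obj).obj (op V)),
      (f.hom.c.app (op V)).app (op ⦋n⦌) s =
        (levelPresheaf n Y.obj).map ((Opens.map f.hom.base).map i).op t
  ker : ∀ (n : ℕ) (U : Opens X.obj) (s : (levelPresheaf n X.obj).obj (op U)),
    CInftyHom.toRingHom ((f.hom.c.app (op U)).app (op ⦋n⦌)) s = 0 ↔
      ∀ x ∈ U, ∃ (V : Opens X.obj) (i : V ⟶ U) (_ : x ∈ V),
        (levelPresheaf n X.obj).map i.op s ∈ X.trivialIdeal n V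

end

/-! A $C^\infty$-ring is localized at a point by passing to a quotient; no fractions are needed. Let
$b$ have value $c\neq 0$ at the point. There are smooth functions $k,g$ on $\mathbb R$ with
$k(c)\neq 0$ and $t\,g(t)=1$ wherever $k(t)\neq 0$ (`SmoothFun.exists_local_inv`), so
$k(b)\,(g(b)\,b-1)=0$ while $k(b)$ has non-zero value. Thus $b$ becomes invertible once elements are
identified whenever they agree after multiplication by some element with non-zero value. This
quotient is `LocAt`. It is applied to the stalks of every $\mathcal O_n$, with multipliers from
$\mathcal O_0$, and the families of localized germs that locally come from sections of $\mathcal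
O_n$ form the sheaf $\mathcal O_\bullet/\mathfrak t\,\mathcal O_\bullet$. If $bs=0$, then $s=\alpha
s$ with $\alpha=1-g(b)\,b$. Where $k(b)$ vanishes nowhere this $\alpha$ is trivial, which identifies
the kernel.

The projection is a local weak equivalence because its kernel is invisible to homotopy. A multiplier
$b$ that does not vanish at $p$ is a unit in the local ring $\pi_0(\mathcal O_\bullet)_p$, so near
$p$ some $w=cb$ is joined to $1$ by an element of $\mathcal O_1$. Multiplication by $w$ is then
simplicially homotopic to the identity (`SCInftyRing.mulHomotopy`) and acts trivially on all
$\pi_k$. Lifting cycles and boundaries locally and multiplying by $w$ to kill the errors gives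
isomorphisms on the homotopy sheaves. In particular $\pi_0$ is unchanged, so the quotient is again a
simplicial $C^\infty$-space.

For the universal property, a local $C^\infty$-ring has only one morphism to $\mathbb R$, so every
morphism of spaces preserves values (`SCInftySpace.valueAt_comp`). Into a localized space it
therefore sends germs with non-zero value to units. It factors through the localized stalks, and the
factorizations glue. -/

noncomputable section

/-! ### Inverting elements by smooth functions -/

namespace SmoothFun

/-- Near a point `c ≠ 0` the function `t⁻¹` is the germ of a smooth function on `ℝ`. -/
theorem exists_local_inv {c : ℝ} (hc : c ≠ 0) :
    ∃ k g : SmoothFun 1, k.1 ![c] ≠ 0 ∧ ∀ x, k.1 x ≠ 0 → x 0 * g.1 x = 1 := by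
  have hc' : 0 < |c| / 4 := by positivity
  have hc2 : |c| / 4 < |c| / 2 := by linarith
  -- With outer radius $|c|/2$ about both $0$ and $c$ the two bumps have disjoint supports. Where
  -- $\kappa\neq 0$ the denominator $t^2+\chi(t)$ below is $t^2$ and $g(t)=1/t$; at $t=0$ it is kept
  -- non-zero by $\chi(0)=1$.
  let χ : ContDiffBump (0 : ℝ) := ⟨|c| / 4, |c| / 2, hc', hc2⟩
  let κ : ContDiffBump c := ⟨|c| / 4, |c| / 2, hc', hc2⟩
  have hden : ∀ t : ℝ, t ^ 2 + χ t ≠ 0 := by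
    intro t
    rcases eq_or_ne t 0 with rfl | ht
    · have : χ (0 : ℝ) = 1 := χ.one_of_mem_closedBall (by simp [hc'.le, χ])
      simp [this]
    · have : 0 < t ^ 2 := by positivity
      have := χ.nonneg (x := t)
      positivity
  have hp : ContDiff ℝ ∞ (fun x : Fin 1 → ℝ => x 0) := contDiff_apply ℝ ℝ 0
  refine ⟨⟨fun x => κ (x 0), κ.contDiff.comp hp⟩,
    ⟨fun x => x 0 / (x 0 ^ 2 + χ (x 0)), hp.div ((hp.pow 2).add (χ.contDiff.comp hp))
      fun x => hden _⟩, ?_, ?_⟩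
  · have : κ c = 1 := κ.one_of_mem_closedBall (by simp [hc'.le, κ])
    simp [this]
  · intro x hx
    have h1 : x 0 ∈ Metric.ball c (|c| / 2) := by
      have : x 0 ∈ Function.support κ := hx
      rwa [κ.support_eq] at this
    have h2 : |c| / 2 ≤ dist (x 0) 0 := by
      rw [Metric.mem_ball, Real.dist_eq] at h1
      rw [Real.dist_eq, sub_zero]
      have := abs_sub_abs_le_abs_sub c (x 0)
      rw [abs_sub_comm] at this
      linarith
    have h3 : χ (x 0) = 0 := χ.zero_of_le_dist h2
    have h0 : x 0 ≠ 0 := by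
      rintro h0
      rw [h0, dist_self] at h2
      linarith
    simp only [h3, add_zero]
    field_simp

end SmoothFun

namespace CInftyRing

variable {A : Type u} [CInftyRing A]

theorem op_congr {n : ℕ} {f g : SmoothFun n} (h : ∀ x, f.1 x = g.1 x) (a : Fin n → A) :
    op f a = op g a := by
  rw [Subtype.ext (funext h)]

theorem op_op_one {n : ℕ} (F : SmoothFun 1) (f : SmoothFun n) (a : Fin n → A) :
    op F ![op f a] = op (SmoothFun.comp F ![f]) a := by
  rw [op_comp]; congr 1; funext i; fin_cases i; rfl

theorem op_mul_op {n : ℕ} (f g : SmoothFun n) (a : Fin n → A) :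
    op f a * op g a = op (SmoothFun.comp SmoothFun.mul ![f, g]) a := by
  rw [op_comp, ← op_mul]; congr 1; funext i; fin_cases i <;> rfl

/-- The constants of a `C^∞`-ring. -/
def const (A : Type u) [CInftyRing A] (r : ℝ) : A := op (SmoothFun.const r : SmoothFun 0) ![]

/-- Multiplying by `k(b)` makes `b` invertible, if `k` vanishes near `0`. -/
theorem op_mul_op_of_inv {k g : SmoothFun 1} (h : ∀ x, k.1 x ≠ 0 → x 0 * g.1 x = 1) (b : A)
    {n : ℕ} (f : SmoothFun n) (x : Fin n → A) :
    op k ![b] * op f x = op k ![b] * op f (fun i => op g ![b] * (b * x i)) := by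
  -- Both sides are values at the tuple $(b,x)$ of smooth functions of $n+1$ variables, so it
  -- suffices to compare these functions pointwise: either $k(w_0)=0$ or $w_0\,g(w_0)=1$.
  let v : Fin (n + 1) → A := Fin.cons b x
  let y : SmoothFun (n + 1) := SmoothFun.proj 0
  have hb : b = op y v := (op_proj 0 v).symm
  have hx : ∀ i : Fin n, x i = op (SmoothFun.proj i.succ) v := fun i => (op_proj i.succ v).symm
  have hx' : x = fun i : Fin n => op (SmoothFun.proj i.succ) v := funext hx
  have hy : (![op y v] : Fin 1 → A) = ![b] := by rw [← hb]
  have e1 : op k ![b] = op (SmoothFun.comp k ![y]) v := by rw [← op_op_one, hy]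
  have e2 : op g ![b] = op (SmoothFun.comp g ![y]) v := by rw [← op_op_one, hy]
  have e3 : (fun i => op g ![b] * (b * x i)) = fun i : Fin n =>
      op (SmoothFun.comp SmoothFun.mul ![SmoothFun.comp g ![y],
        SmoothFun.comp SmoothFun.mul ![y, SmoothFun.proj i.succ]]) v := by
    funext i
    rw [e2, ← op_mul_op, ← op_mul_op, ← hx, ← hb]
  have e4 : op f x = op (SmoothFun.comp f fun i => SmoothFun.proj i.succ) v := by
    rw [op_comp, ← hx']
  rw [e1, e3, ← op_comp, e4, op_mul_op, op_mul_op]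
  refine op_congr (fun w => ?_) v
  have hv : (fun i => ((![y] : Fin 1 → SmoothFun (n + 1)) i).1 w) = ![w 0] := by
    funext i; fin_cases i; rfl
  change k.1 (fun i => ((![y] : Fin 1 → SmoothFun (n + 1)) i).1 w) * f.1 (fun i => w i.succ) =
    k.1 (fun i => ((![y] : Fin 1 → SmoothFun (n + 1)) i).1 w) * f.1 (fun i =>
      g.1 (fun i => ((![y] : Fin 1 → SmoothFun (n + 1)) i).1 w) * (w 0 * w i.succ))
  rw [hv]
  rcases eq_or_ne (k.1 ![w 0]) 0 with hk | hk
  · rw [hk, zero_mul, zero_mul]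
  · have := h _ hk
    refine congrArg (fun z => k.1 ![w 0] * f.1 z) (funext fun i => ?_)
    rw [← mul_assoc, mul_comm (g.1 _)]
    change _ = ((![w 0] : Fin 1 → ℝ) 0 * _) * _
    rw [this, one_mul]

/-- This is `op_mul_op_of_inv` for a coordinate function evaluated at $1$. It says that $g(b)$
inverts $b$ up to the multiplier $k(b)$. -/
theorem op_mul_inv {k g : SmoothFun 1} (h : ∀ x, k.1 x ≠ 0 → x 0 * g.1 x = 1) (b : A) :
    op k ![b] * (op g ![b] * b) = op k ![b] := by
  have h1 := op_mul_op_of_inv h b (SmoothFun.proj 0 : SmoothFun 1) (fun _ => 1)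
  rw [op_proj, op_proj, mul_one, mul_one] at h1
  exact h1.symm

end CInftyRing

namespace CInftyHom

variable {A : Type u} {B : Type v} {D : Type w} [CInftyRing A] [CInftyRing B] [CInftyRing D]

theorem op_apply (φ : CInftyHom A B) {n : ℕ} (f : SmoothFun n) (a : Fin n → A) :
    φ (CInftyRing.op f a) = CInftyRing.op f (fun i => φ (a i)) := φ.map_op f a

theorem op_apply_one (φ : CInftyHom A B) (f : SmoothFun 1) (a : A) :
    φ (CInftyRing.op f ![a]) = CInftyRing.op f ![φ a] := by
  rw [op_apply]; congr 1; funext i; fin_cases i; rfl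

theorem map_zero (φ : CInftyHom A B) : φ 0 = 0 := φ.toRingHom.map_zero

theorem map_sub (φ : CInftyHom A B) (a b : A) : φ (a - b) = φ a - φ b := φ.toRingHom.map_sub a b

theorem isUnit_map (φ : CInftyHom A B) {a : A} (h : IsUnit a) : IsUnit (φ a) :=
  h.map φ.toRingHom

@[simp] theorem comp_apply (g : CInftyHom B D) (f : CInftyHom A B) (a : A) :
    g.comp f a = g (f a) := rfl

theorem apply_const (φ : CInftyHom A ℝ) (r : ℝ) : φ (CInftyRing.const A r) = r :=
  φ.op_apply _ _

theorem hom_ext {f g : CInftyHom A B} (h : ∀ a, f a = g a) : f = g :=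
  CInftyHom.ext (funext h)

/-- The inverse of a bijective morphism. -/
def inverse (f : CInftyHom A B) (hf : Function.Bijective f) : CInftyHom B A where
  toFun := Function.surjInv hf.2
  map_op k b := hf.1 (by
    rw [Function.surjInv_eq hf.2, op_apply]
    congr 1; funext i; exact (Function.surjInv_eq hf.2 _).symm)

theorem apply_inverse (f : CInftyHom A B) (hf : Function.Bijective f) (b : B) :
    f (f.inverse hf b) = b := Function.surjInv_eq hf.2 b

end CInftyHom

/-! ### Local and finitely generated $C^\infty$-rings -/

namespace CInftyRing

variable {A : Type u} {B : Type v} [CInftyRing A] [CInftyRing B]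

/-- For the converse, the nonunits are exactly the kernel of `φ`, hence closed under addition, and
`φ` is surjective because it fixes the constants. -/
theorem isLocal_iff : IsLocal A ↔ ∃ φ : CInftyHom A ℝ, ∀ a, φ a ≠ 0 → IsUnit a := by
  constructor
  · rintro ⟨_, φ, _, hφ⟩
    refine ⟨φ, fun a ha => ?_⟩
    by_contra h
    have : a ∈ IsLocalRing.maximalIdeal A := h
    rw [← hφ] at this
    exact ha this
  · rintro ⟨φ, hφ⟩
    have : Nontrivial A := ⟨⟨0, 1, fun h => by
      have := congrArg φ h
      rw [φ.map_zero, φ.map_one] at this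
      exact zero_ne_one this⟩⟩
    have hu : ∀ a, a ∈ nonunits A ↔ φ a = 0 := fun a =>
      ⟨fun h => by_contra fun h' => h (hφ a h'), fun h h' => by
        have := φ.isUnit_map h'
        rw [h] at this
        exact not_isUnit_zero this⟩
    have hl : IsLocalRing A := IsLocalRing.of_nonunits_add fun a b ha hb => by
      rw [hu] at *
      rw [φ.map_add, ha, hb, add_zero]
    exact ⟨hl, φ, fun r => ⟨_, φ.apply_const r⟩, Ideal.ext fun a => (hu a).symm⟩

theorem IsLocal.isUnit_of_residue_ne_zero (h : IsLocal A) {a : A} (ha : h.residue a ≠ 0) :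
    IsUnit a := by
  by_contra h'
  have h2 : RingHom.ker h.residue.toRingHom = @IsLocalRing.maximalIdeal A _ h.choose :=
    h.choose_spec.choose_spec.2
  have : a ∈ @IsLocalRing.maximalIdeal A _ h.choose := h'
  rw [← h2] at this
  exact ha this

/-- For any `χ`, the element $a-\chi(a)$ is killed by `χ`, so it is not a unit and its residue
vanishes; hence `χ` is the residue map. For this reason morphisms of spaces need no locality
condition in order to preserve values. -/
theorem IsLocal.hom_ext (h : IsLocal A) (φ ψ : CInftyHom A ℝ) : φ = ψ := by
  have key : ∀ χ : CInftyHom A ℝ, ∀ a, χ a = h.residue a := by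
    intro χ a
    have h1 : h.residue (a - const A (χ a)) = 0 := by
      by_contra h'
      have := χ.isUnit_map (h.isUnit_of_residue_ne_zero h')
      rw [χ.map_sub, χ.apply_const, sub_self] at this
      exact not_isUnit_zero this
    rw [CInftyHom.map_sub, CInftyHom.apply_const, sub_eq_zero] at h1
    exact h1.symm
  exact CInftyHom.hom_ext fun a => (key φ a).trans (key ψ a).symm

theorem IsLocal.isUnit_of_ne_zero (h : IsLocal A) (φ : CInftyHom A ℝ) {a : A} (ha : φ a ≠ 0) :
    IsUnit a :=
  h.isUnit_of_residue_ne_zero (by rwa [h.hom_ext h.residue φ])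

theorem IsLocal.of_bijective (h : IsLocal A) (f : CInftyHom A B) (hf : Function.Bijective f) :
    IsLocal B := by
  obtain ⟨φ, hφ⟩ := isLocal_iff.1 h
  refine isLocal_iff.2 ⟨φ.comp (f.inverse hf), fun b hb => ?_⟩
  rw [← f.apply_inverse hf b]
  exact f.isUnit_map (hφ _ hb)

theorem FinGen.of_surjective (h : FinGen A) (f : CInftyHom A B) (hf : Function.Surjective f) :
    FinGen B := by
  obtain ⟨n, a, ha⟩ := h
  refine ⟨n, fun i => f (a i), fun b => ?_⟩
  obtain ⟨a', rfl⟩ := hf b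
  obtain ⟨k, rfl⟩ := ha a'
  exact ⟨k, (f.op_apply k a).symm⟩

end CInftyRing

/-! ## Localization of a `C^∞`-algebra at a point -/

/-- For a `C^∞`-ring `A`, a morphism `d : A → M` and a point `χ : A → ℝ`, the congruence on `M` of
equality up to multiplication by elements of `A` that do not vanish at `χ`. -/
def pointCongr {A M : Type u} [CInftyRing A] [CInftyRing M] (d : CInftyHom A M)
    (χ : CInftyHom A ℝ) : Setoid M where
  r x y := ∃ b, χ b ≠ 0 ∧ d b * x = d b * y
  iseqv := by
    refine ⟨fun x => ⟨1, by simp [χ.map_one], rfl⟩, ?_, ?_⟩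
    · rintro x y ⟨b, hb, h⟩
      exact ⟨b, hb, h.symm⟩
    · rintro x y z ⟨b, hb, h⟩ ⟨b', hb', h'⟩
      refine ⟨b * b', by rw [χ.map_mul]; exact mul_ne_zero hb hb', ?_⟩
      rw [d.map_mul, mul_right_comm, h, mul_right_comm, mul_assoc, h', ← mul_assoc]

/-- The localization of `M` at the point `χ` of `A`. -/
def LocAt {A M : Type u} [CInftyRing A] [CInftyRing M] (d : CInftyHom A M)
    (χ : CInftyHom A ℝ) : Type u := Quotient (pointCongr d χ)

namespace LocAt

variable {A M : Type u} [CInftyRing A] [CInftyRing M] {d : CInftyHom A M} {χ : CInftyHom A ℝ}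

variable (d χ) in
/-- The class of an element. -/
def mk (x : M) : LocAt d χ := Quotient.mk (pointCongr d χ) x

theorem mk_surjective : Function.Surjective (mk d χ) := Quotient.mk_surjective

theorem mk_eq_mk {x y : M} : mk d χ x = mk d χ y ↔ ∃ b, χ b ≠ 0 ∧ d b * x = d b * y :=
  Quotient.eq (r := pointCongr d χ)

/-- A common multiplier for finitely many relations. -/
theorem exists_common {n : ℕ} {x y : Fin n → M} (h : ∀ i, mk d χ (x i) = mk d χ (y i)) :
    ∃ b, χ b ≠ 0 ∧ ∀ i, d b * x i = d b * y i := by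
  choose b hb h using fun i => mk_eq_mk.1 (h i)
  refine ⟨∏ i, b i, ?_, fun i => ?_⟩
  · change χ.toRingHom (∏ i, b i) ≠ 0
    rw [map_prod]
    exact Finset.prod_ne_zero_iff.2 fun i _ => hb i
  · rw [← Finset.mul_prod_erase _ _ (Finset.mem_univ i), d.map_mul, mul_right_comm, h i,
      mul_right_comm]

/-- For a common multiplier $b$, `op_mul_op_of_inv` shows that $k(b)\,f(x)$ depends on $x$ only
through the products $b\,x_i$. Hence $k(b)$ is a multiplier for the values of $f$, and the
congruence respects all smooth operations, not only the ring operations. -/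
theorem op_congr {n : ℕ} (f : SmoothFun n) {x y : Fin n → M}
    (h : ∀ i, mk d χ (x i) = mk d χ (y i)) :
    mk d χ (CInftyRing.op f x) = mk d χ (CInftyRing.op f y) := by
  obtain ⟨b, hb, hxy⟩ := exists_common h
  obtain ⟨k, g, hk, hkg⟩ := SmoothFun.exists_local_inv hb
  refine mk_eq_mk.2 ⟨CInftyRing.op k ![b], ?_, ?_⟩
  · rw [χ.op_apply_one]; exact hk
  · rw [d.op_apply_one, CInftyRing.op_mul_op_of_inv hkg, CInftyRing.op_mul_op_of_inv hkg (d b) f y]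
    simp only [hxy]

instance : CInftyRing (LocAt d χ) := CInftyRing.ofOps
  { op := fun f a => mk d χ (CInftyRing.op f fun i => Quotient.out (a i))
    op_proj := fun _ _ => by
      rw [CInftyRing.op_proj]; exact Quotient.out_eq _
    op_comp := fun f _ _ => by
      rw [CInftyRing.op_comp]
      exact op_congr f fun _ => (Quotient.out_eq _).symm }

variable (d χ) in
/-- The projection to the localization. -/
def proj : CInftyHom M (LocAt d χ) where
  toFun := mk d χ
  map_op f _ := op_congr f fun _ => (Quotient.out_eq (s := pointCongr d χ) _).symm

@[simp] theorem proj_apply (x : M) : proj d χ x = mk d χ x := rfl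

/-- Morphisms out of the localization. -/
def lift {N : Type v} [CInftyRing N] (f : CInftyHom M N)
    (h : ∀ b, χ b ≠ 0 → IsUnit (f (d b))) : CInftyHom (LocAt d χ) N where
  toFun := Quotient.lift (s := pointCongr d χ) f (by
    rintro x y ⟨b, hb, e⟩
    have := congrArg f e
    rw [f.map_mul, f.map_mul] at this
    exact (h b hb).mul_left_cancel this)
  map_op k a := by
    choose x hx using fun i => mk_surjective (a i)
    obtain rfl : a = fun i => proj d χ (x i) := funext fun i => (hx i).symm
    rw [← (proj d χ).op_apply]
    exact f.op_apply k x

/-- Functoriality of the localization. -/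
def map {N : Type u} [CInftyRing N] {d' : CInftyHom A N} (f : CInftyHom M N)
    (h : ∀ b, f (d b) = d' b) : CInftyHom (LocAt d χ) (LocAt d' χ) where
  toFun := Quotient.map (sa := pointCongr d χ) (sb := pointCongr d' χ) f (by
    rintro x y ⟨b, hb, e⟩
    refine ⟨b, hb, ?_⟩
    rw [← h, ← f.map_mul, ← f.map_mul, e])
  map_op k a := by
    choose x hx using fun i => mk_surjective (a i)
    obtain rfl : a = fun i => proj d χ (x i) := funext fun i => (hx i).symm
    rw [← (proj d χ).op_apply]
    change mk d' χ (f _) = CInftyRing.op k fun i => proj d' χ (f (x i))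
    rw [f.op_apply, ← (proj d' χ).op_apply]
    rfl

/-- The inverse is the class of $g(b)$, with multiplier $k(b)$. Since it already comes from `A`, the
quotient is a genuine localization. -/
theorem isUnit_mk {b : A} (hb : χ b ≠ 0) : IsUnit (mk d χ (d b)) := by
  obtain ⟨k, g, hk, hkg⟩ := SmoothFun.exists_local_inv hb
  refine IsUnit.of_mul_eq_one (mk d χ (d (CInftyRing.op g ![b]))) ?_
  rw [← proj_apply, ← proj_apply, ← CInftyHom.map_mul, ← (proj d χ).map_one]
  refine mk_eq_mk.2 ⟨CInftyRing.op k ![b], ?_, ?_⟩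
  · rw [χ.op_apply_one]; exact hk
  · rw [← d.map_one, ← d.map_mul, ← d.map_mul, ← d.map_mul, mul_one, mul_comm b,
      CInftyRing.op_mul_inv hkg]

-- A morphism that inverts the multipliers identifies congruent elements, so it descends to the
-- quotient; uniqueness is the surjectivity of the projection.
variable (χ) in
theorem isCInftyLocalization :
    IsCInftyLocalization {a | χ a ≠ 0} (proj (CInftyHom.id A) χ) where
  isUnit _ hs := isUnit_mk (d := CInftyHom.id A) hs
  lift D _ g hg := by
    refine ⟨lift g hg, rfl, fun h hh => CInftyHom.hom_ext fun a => ?_⟩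
    obtain ⟨x, rfl⟩ := mk_surjective a
    exact congrArg (fun k : CInftyHom A D => k x) hh

end LocAt

/-- Any localization maps to the explicit model `LocAt` compatibly with the maps from `A`, so its
kernel is contained in the one computed there. Conversely, `ℓ` makes the multiplier a unit. -/
theorem IsCInftyLocalization.apply_eq_zero_iff {A B : Type u} [CInftyRing A] [CInftyRing B]
    {χ : CInftyHom A ℝ} {ℓ : CInftyHom A B} (h : IsCInftyLocalization {a | χ a ≠ 0} ℓ) (a : A) :
    ℓ a = 0 ↔ ∃ b, χ b ≠ 0 ∧ b * a = 0 := by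
  constructor
  · intro ha
    obtain ⟨k, hk, -⟩ := h.lift _ _ (LocAt.isCInftyLocalization χ).isUnit
    have h1 : LocAt.proj (CInftyHom.id A) χ a = 0 := by
      rw [← hk, CInftyHom.comp_apply, ha, k.map_zero]
    rw [← (LocAt.proj (CInftyHom.id A) χ).map_zero] at h1
    obtain ⟨b, hb, hab⟩ := LocAt.mk_eq_mk.1 h1
    rw [mul_zero] at hab
    exact ⟨b, hb, hab⟩
  · rintro ⟨b, hb, hab⟩
    have h1 := congrArg ℓ hab
    rw [ℓ.map_mul, ℓ.map_zero] at h1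
    exact (h.isUnit b hb).mul_right_eq_zero.1 h1

/-! ### Stalks of presheaves of $C^\infty$-rings -/

namespace TopCat.Presheaf

variable {X : TopCat.{u}}

section CStalk

variable (F : X.Presheaf CInftyRingCat.{u})

theorem exists_cgerm_eq {x : X} (a : F.CStalk x) :
    ∃ (U : Opens X) (hx : x ∈ U) (s : F.obj (op U)), F.cgerm U x hx s = a := by
  obtain ⟨U, hx, s, hs⟩ := exists_germ_eq F.sets (x := x) a
  exact ⟨U, hx, s, hs⟩

theorem exists_res_eq_of_cgerm_eq {U V : Opens X} {x : X} {hU : x ∈ U} {hV : x ∈ V}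
    {s : F.obj (op U)} {t : F.obj (op V)} (h : F.cgerm U x hU s = F.cgerm V x hV t) :
    ∃ (W : Opens X) (_ : x ∈ W) (i : W ⟶ U) (j : W ⟶ V), F.map i.op s = F.map j.op t :=
  germ_eq F.sets x hU hV s t h

/-- The germ at a point as a morphism of `C^∞`-rings. -/
def germHom (U : Opens X) (x : X) (hx : x ∈ U) : CInftyHom (F.obj (op U)) (F.CStalk x) where
  toFun := F.cgerm U x hx
  map_op f s := (F.cstalkOp_cgerm x f hx s).symm

theorem cgerm_op (U : Opens X) (x : X) (hx : x ∈ U) {n : ℕ} (f : SmoothFun n)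
    (s : Fin n → F.obj (op U)) :
    F.cgerm U x hx (CInftyRing.op f s) = CInftyRing.op f fun i => F.cgerm U x hx (s i) :=
  (F.germHom U x hx).op_apply f s

theorem cgerm_mul (U : Opens X) (x : X) (hx : x ∈ U) (s t : F.obj (op U)) :
    F.cgerm U x hx (s * t) = F.cgerm U x hx s * F.cgerm U x hx t := (F.germHom U x hx).map_mul s t

theorem cgerm_zero (U : Opens X) (x : X) (hx : x ∈ U) : F.cgerm U x hx 0 = 0 :=
  (F.germHom U x hx).map_zero

variable {F}

/-- Sections of a sheaf of `C^∞`-rings are determined by their germs. -/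
theorem cgerm_ext (hF : F.sets.IsSheaf) {U : Opens X} {s t : F.obj (op U)}
    (h : ∀ (x : X) (hx : x ∈ U), F.cgerm U x hx s = F.cgerm U x hx t) : s = t :=
  section_ext ⟨F.sets, hF⟩ U s t h

/-- A family of germs of a sheaf of `C^∞`-rings that is locally represented by sections is
represented by a section. -/
theorem exists_section (hF : F.sets.IsSheaf) {U : Opens X} (s : ∀ x : X, x ∈ U → F.CStalk x)
    (h : ∀ x ∈ U, ∃ (V : Opens X) (_ : x ∈ V) (_ : V ≤ U) (t : F.obj (op V)),
      ∀ (y : X) (hy : y ∈ V) (hyU : y ∈ U), s y hyU = F.cgerm V y hy t) :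
    ∃ t : F.obj (op U), ∀ (x : X) (hx : x ∈ U), F.cgerm U x hx t = s x hx := by
  choose V hV hVU t ht using fun x : U => h x.1 x.2
  have hc : IsCompatible F.sets V t := by
    intro x y
    refine cgerm_ext (F := F) hF fun z hz => ?_
    refine (F.cgerm_res _ z hz (t x)).trans (Eq.trans ?_ (F.cgerm_res _ z hz (t y)).symm)
    rw [← ht x z hz.1 (hVU x hz.1), ← ht y z hz.2 (hVU x hz.1)]
  obtain ⟨t', ht', -⟩ := TopCat.Sheaf.existsUnique_gluing' ⟨F.sets, hF⟩ V U
    (fun x => homOfLE (hVU x)) (fun x hx => Opens.mem_iSup.2 ⟨⟨x, hx⟩, hV _⟩) t hc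
  refine ⟨t', fun x hx => ?_⟩
  have h1 : F.map (homOfLE (hVU ⟨x, hx⟩)).op t' = t ⟨x, hx⟩ := ht' ⟨x, hx⟩
  rw [ht ⟨x, hx⟩ x (hV ⟨x, hx⟩) hx, ← h1, cgerm_res]

end CStalk

/-- The map induced on stalks by a morphism of presheaves of `C^∞`-rings. -/
def cstalkHom {F G : X.Presheaf CInftyRingCat.{u}} (α : F ⟶ G) (x : X) :
    CInftyHom (F.CStalk x) (G.CStalk x) where
  toFun := (stalkFunctor (Type u) x).map (Functor.whiskerRight α (forget CInftyRingCat.{u}))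
  map_op f a := by
    obtain ⟨U, hx, s, rfl⟩ := F.exists_cgerm x a
    have h : ∀ s : F.obj (op U), (stalkFunctor (Type u) x).map
        (Functor.whiskerRight α (forget CInftyRingCat.{u})) (F.cgerm U x hx s) =
          G.cgerm U x hx (α.app (op U) s) := fun s =>
      stalkFunctor_map_germ_apply U x hx (Functor.whiskerRight α (forget CInftyRingCat.{u})) s
    rw [← cgerm_op]
    simp only [h]
    rw [← cgerm_op]
    exact congrArg _ (CInftyHom.map_op (α.app (op U)) f s)

theorem cstalkHom_cgerm {F G : X.Presheaf CInftyRingCat.{u}} (α : F ⟶ G) (U : Opens X) (x : X)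
    (hx : x ∈ U) (s : F.obj (op U)) :
    cstalkHom α x (F.cgerm U x hx s) = G.cgerm U x hx (α.app (op U) s) :=
  stalkFunctor_map_germ_apply U x hx (Functor.whiskerRight α (forget CInftyRingCat.{u})) s

end TopCat.Presheaf

/-! ### Maps induced on stalks and on associated sheaves -/

namespace AlgebraicGeometry.PresheafedSpace

/-- The underlying space with a presheaf of sets. -/
abbrev sets (X : PresheafedSpace.{u} CInftyRingCat.{u}) : PresheafedSpace.{u} (Type u) :=
  ⟨X.carrier, X.presheaf.sets⟩

/-- The underlying morphism of spaces with presheaves of sets. -/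
abbrev setsMap {Y X : PresheafedSpace.{u} CInftyRingCat.{u}} (g : Y ⟶ X) : sets Y ⟶ sets X where
  base := g.base
  c := Functor.whiskerRight g.c (CategoryTheory.forget CInftyRingCat.{u})

/-- The map induced on stalks by a morphism of spaces with presheaves of `C^∞`-rings. -/
def cstalkMap {Y X : PresheafedSpace.{u} CInftyRingCat.{u}} (g : Y ⟶ X) (y : Y) :
    CInftyHom (X.presheaf.CStalk (g.base y)) (Y.presheaf.CStalk y) where
  toFun := (setsMap g).stalkMap y
  map_op f a := by
    obtain ⟨U, hx, s, rfl⟩ := X.presheaf.exists_cgerm _ a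
    have h : ∀ s : X.presheaf.obj (op U), (setsMap g).stalkMap y
        (X.presheaf.cgerm U (g.base y) hx s) =
          Y.presheaf.cgerm ((Opens.map g.base).obj U) y hx (g.c.app (op U) s) := fun s =>
      PresheafedSpace.stalkMap_germ_apply (setsMap g) U y hx s
    rw [← TopCat.Presheaf.cgerm_op]
    simp only [h]
    refine Eq.trans ?_ (TopCat.Presheaf.cgerm_op _ _ _ _ _ _)
    exact congrArg _ (CInftyHom.map_op (g.c.app (op U)) f s)

theorem cstalkMap_cgerm {Y X : PresheafedSpace.{u} CInftyRingCat.{u}} (g : Y ⟶ X) (y : Y)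
    (U : Opens X) (hx : g.base y ∈ U) (s : X.presheaf.obj (op U)) :
    cstalkMap g y (X.presheaf.cgerm U (g.base y) hx s) =
      Y.presheaf.cgerm ((Opens.map g.base).obj U) y hx (g.c.app (op U) s) :=
  PresheafedSpace.stalkMap_germ_apply (setsMap g) U y hx s

/-! ### Maps that are locally bijective on sections -/

section LocallyBijective

variable {P Q : PresheafedSpace.{u} (Type u)} (g : P ⟶ Q)

/-- Sections with the same image agree locally. -/
def IsLocallyInj : Prop :=
  ∀ (V : Opens Q) (s t : Q.presheaf.obj (op V)), g.c.app (op V) s = g.c.app (op V) t →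
    ∀ x ∈ V, ∃ (W : Opens Q) (i : W ⟶ V), x ∈ W ∧ Q.presheaf.map i.op s = Q.presheaf.map i.op t

/-- Sections over the preimage of an open set locally have a preimage. -/
def IsLocallySurj : Prop :=
  ∀ (V : Opens Q) (t : P.presheaf.obj (op ((Opens.map g.base).obj V))),
    ∀ x ∈ V, ∃ (W : Opens Q) (i : W ⟶ V) (s : Q.presheaf.obj (op W)), x ∈ W ∧
      g.c.app (op W) s = P.presheaf.map ((Opens.map g.base).map i).op t

variable {g}

theorem exists_opens_map_eq (hg : IsHomeomorph g.base) (U : Opens P) :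
    ∃ V : Opens Q, U = (Opens.map g.base).obj V :=
  ⟨⟨g.base '' U, hg.isOpenMap _ U.isOpen⟩,
    Opens.ext (Set.preimage_image_eq _ hg.injective).symm⟩

/-- Since the base map is a homeomorphism, every neighbourhood of `x` is the preimage of an open
set, so a germ of `P` at `x` is represented by a section of the direct image. The two local
conditions then apply. -/
theorem stalkMap_bijective (hg : IsHomeomorph g.base) (hi : IsLocallyInj g)
    (hs : IsLocallySurj g) (x : P) : Function.Bijective (g.stalkMap x) := by
  constructor
  · intro a b hab
    obtain ⟨U, hU, s, rfl⟩ := Q.presheaf.exists_germ_eq a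
    obtain ⟨V, hV, t, rfl⟩ := Q.presheaf.exists_germ_eq b
    rw [stalkMap_germ_apply, stalkMap_germ_apply] at hab
    obtain ⟨W, hW, i, j, h⟩ := P.presheaf.germ_eq x hU hV _ _ hab
    obtain ⟨W, rfl⟩ := exists_opens_map_eq hg W
    have hWU : W ≤ U := fun y hy => by
      obtain ⟨z, rfl⟩ := hg.surjective y
      exact i.le hy
    have hWV : W ≤ V := fun y hy => by
      obtain ⟨z, rfl⟩ := hg.surjective y
      exact j.le hy
    have h1 := NatTrans.naturality_apply g.c (homOfLE hWU).op s
    have h2 := NatTrans.naturality_apply g.c (homOfLE hWV).op t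
    obtain ⟨W', k, hx, h3⟩ := hi W (Q.presheaf.map (homOfLE hWU).op s)
      (Q.presheaf.map (homOfLE hWV).op t) (h1.trans (h.trans h2.symm)) _ hW
    rw [← Q.presheaf.germ_res_apply (homOfLE hWU) _ hW, ← Q.presheaf.germ_res_apply k _ hx, h3,
      Q.presheaf.germ_res_apply k, Q.presheaf.germ_res_apply (homOfLE hWV)]
  · intro a
    obtain ⟨U, hU, t, rfl⟩ := P.presheaf.exists_germ_eq a
    obtain ⟨V, rfl⟩ := exists_opens_map_eq hg U
    obtain ⟨W, i, s, hx, h⟩ := hs V t _ hU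
    refine ⟨Q.presheaf.germ W _ hx s, ?_⟩
    rw [stalkMap_germ_apply, h]
    exact P.presheaf.germ_res_apply ((Opens.map g.base).map i) x hx t

theorem sectionsMap_bijective (hg : IsHomeomorph g.base)
    (hb : ∀ x, Function.Bijective (g.stalkMap x)) (Z : Set Q) :
    Function.Bijective (Hom.sectionsMap g Z) := by
  constructor
  · intro s t h
    refine TopCat.Presheaf.Sections.ext (funext fun ⟨y, hy⟩ => ?_)
    obtain ⟨x, rfl⟩ := hg.surjective y
    exact (hb x).1 (congrFun (congrArg TopCat.Presheaf.Sections.val h) ⟨x, hy⟩)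
  · intro t
    -- The germ has to be chosen at the point `y` of `Q`, whereas the stalk map is defined at `x`;
    -- the transport along `g x = y` is removed again in `ha'`.
    have hex : ∀ y : Z, ∃ a : Q.presheaf.stalk y.1, ∀ (x : P) (hx : g.base x = y.1),
        g.stalkMap x (Q.presheaf.stalkCongr (.of_eq hx.symm) |>.hom a) =
          t.val ⟨x, show g.base x ∈ Z from hx ▸ y.2⟩ := by
      rintro ⟨y, hy⟩
      obtain ⟨x, rfl⟩ := hg.surjective y
      obtain ⟨a, ha⟩ := (hb x).2 (t.val ⟨x, hy⟩)
      refine ⟨a, fun x' hx' => ?_⟩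
      obtain rfl := hg.injective hx'
      rw [← ha]
      simp [TopCat.Presheaf.stalkCongr]
    choose a ha using hex
    have ha' : ∀ (x : P) (hx : g.base x ∈ Z), g.stalkMap x (a ⟨g.base x, hx⟩) = t.val ⟨x, hx⟩ := by
      intro x hx
      rw [← ha ⟨g.base x, hx⟩ x rfl]
      simp [TopCat.Presheaf.stalkCongr]
    refine ⟨⟨a, ?_⟩, TopCat.Presheaf.Sections.ext (funext fun ⟨x, hx⟩ => ha' x hx)⟩
    rintro ⟨y, hy⟩
    obtain ⟨x, rfl⟩ := hg.surjective y
    obtain ⟨U, hU, t', ht'⟩ := t.locallyGerm ⟨x, hy⟩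
    -- To see that the chosen germs come locally from a section, one germ is lifted and spread out
    -- to a section `s`. Its image agrees with `t'` on a neighbourhood, and injectivity on stalks
    -- forces the chosen germs there to be those of `s`.
    obtain ⟨b, hb'⟩ := (hb x).2 (P.presheaf.germ U x hU t')
    obtain ⟨V, hV, s, rfl⟩ := Q.presheaf.exists_germ_eq b
    rw [stalkMap_germ_apply] at hb'
    obtain ⟨W, hW, i, j, h⟩ := P.presheaf.germ_eq x hV hU _ _ hb'
    obtain ⟨W, rfl⟩ := exists_opens_map_eq hg W
    have hWV : W ≤ V := fun y hy => by
      obtain ⟨z, rfl⟩ := hg.surjective y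
      exact i.le hy
    refine ⟨W, hW, Q.presheaf.map (homOfLE hWV).op s, ?_⟩
    rintro ⟨w, hw⟩ hwW
    obtain ⟨z, rfl⟩ := hg.surjective w
    refine (hb z).1 ?_
    rw [ha' z hw, stalkMap_germ_apply, ht' ⟨z, hw⟩ (j.le hwW)]
    have h1 := NatTrans.naturality_apply g.c (homOfLE hWV).op s
    refine Eq.trans ?_ (congrArg (P.presheaf.germ _ z hwW) (h1.trans h)).symm
    exact (P.presheaf.germ_res_apply j z hwW t').symm

end LocallyBijective

end AlgebraicGeometry.PresheafedSpace

/-! ### Multiplication by homotopic elements of $A_0$ -/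

namespace SimplexCategory

/-- The map `[n] → [1]` sending `0, …, i` to `0` and the rest to `1`; here `i` may be `-1`, i.e. the
parameter is the number of elements sent to `0`. -/
def cut {n : ℕ} (i : ℕ) : ⦋n⦌ ⟶ ⦋1⦌ :=
  mkHom ⟨fun j => if (j : ℕ) < i then 0 else 1, fun a b hab => by
    dsimp only
    split_ifs with h1 h2
    · exact le_rfl
    · exact Fin.zero_le _
    · have : (a : ℕ) ≤ b := hab
      omega
    · exact le_rfl⟩

theorem hom_to_one_ext {n : ℕ} {f g : ⦋n⦌ ⟶ ⦋1⦌} (h : ∀ j, f.toOrderHom j = g.toOrderHom j) :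
    f = g := Hom.ext _ _ (OrderHom.ext _ _ (funext h))

theorem δ_cut {n : ℕ} (j : Fin (n + 2)) (i i' : ℕ)
    (h : ∀ k : Fin (n + 1), (j.succAbove k : ℕ) < i ↔ (k : ℕ) < i') :
    δ j ≫ cut i = cut i' := by
  refine hom_to_one_ext fun k => ?_
  change (if (j.succAbove k : ℕ) < i then (0 : Fin 2) else 1) = if (k : ℕ) < i' then 0 else 1
  simp only [h]

theorem σ_cut {n : ℕ} (j : Fin (n + 1)) (i i' : ℕ)
    (h : ∀ k : Fin (n + 2), (j.predAbove k : ℕ) < i ↔ (k : ℕ) < i') :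
    σ j ≫ cut i = cut i' := by
  refine hom_to_one_ext fun k => ?_
  change (if (j.predAbove k : ℕ) < i then (0 : Fin 2) else 1) = if (k : ℕ) < i' then 0 else 1
  simp only [h]

end SimplexCategory

namespace SCInftyRing

open SimplexCategory

variable (A : SCInftyRing.{u})

/-- Because $[0]$ is terminal in the simplex category, all simplicial operators are linear over
$A_0$; this makes `mulMap` a simplicial map. -/
theorem degeneracy_map {m n : ℕ} (θ : ⦋m⦌ ⟶ ⦋n⦌) (a : A _⦋0⦌) :
    A.map θ.op (degeneracy n A a) = degeneracy m A a := by
  change (A.map (SimplexCategory.const ⦋n⦌ ⦋0⦌ 0).op ≫ A.map θ.op) a = _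
  rw [← A.map_comp, ← op_comp]
  rfl

/-- The underlying simplicial abelian group. -/
def toAb : SCInftyRing.{u} ⥤ SimplicialObject AddCommGrpCat.{u} :=
  (SimplicialObject.whiskering _ _).obj CInftyRingCat.toAddCommGrp

variable {A} in
/-- Multiplication by an element of `A_n`. -/
def mulBy {Δ : SimplexCategoryᵒᵖ} (w : A.obj Δ) : (toAb.obj A).obj Δ ⟶ (toAb.obj A).obj Δ :=
  AddCommGrpCat.ofHom (AddMonoidHom.mulLeft (w : A.obj Δ))

variable {A} in
theorem mulBy_map {Δ Δ' : SimplexCategoryᵒᵖ} (w : A.obj Δ) (θ : Δ ⟶ Δ') :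
    mulBy w ≫ (toAb.obj A).map θ = (toAb.obj A).map θ ≫ mulBy (A.map θ w) := by
  ext x
  exact (A.map θ).map_mul w x

/-- Multiplication by an element of `A_0`. -/
def mulMap (a : A _⦋0⦌) : toAb.obj A ⟶ toAb.obj A where
  app Δ := mulBy (degeneracy Δ.unop.len A a)
  naturality Δ Δ' θ := by
    rw [mulBy_map]
    congr 2
    exact (degeneracy_map A θ.unop a).symm

theorem map_cut_δ {n : ℕ} (z : A _⦋1⦌) (j : Fin (n + 2)) (i i' : ℕ)
    (h : ∀ k : Fin (n + 1), (j.succAbove k : ℕ) < i ↔ (k : ℕ) < i') :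
    A.δ j (A.map (cut (n := n + 1) i).op z) = A.map (cut i').op z := by
  rw [← δ_cut j i i' h, op_comp, A.map_comp]
  rfl

theorem map_cut_σ {n : ℕ} (z : A _⦋1⦌) (j : Fin (n + 1)) (i i' : ℕ)
    (h : ∀ k : Fin (n + 2), (j.predAbove k : ℕ) < i ↔ (k : ℕ) < i') :
    A.σ j (A.map (cut (n := n) i).op z) = A.map (cut i').op z := by
  rw [← σ_cut j i i' h, op_comp, A.map_comp]
  rfl

/-- With no element sent to $0$ the map is constant at the vertex $1$, which is the image of the
coface `δ 0`. In `map_cut_last` it is constant at $0$, the image of `δ 1`. -/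
theorem map_cut_zero {n : ℕ} (z : A _⦋1⦌) :
    A.map (cut (n := n) 0).op z = degeneracy n A (A.δ 0 z) := by
  have h : cut (n := n) 0 = SimplexCategory.const ⦋n⦌ ⦋0⦌ 0 ≫ SimplexCategory.δ 0 :=
    hom_to_one_ext fun k => rfl
  rw [h, op_comp, A.map_comp]
  rfl

theorem map_cut_last {n : ℕ} (z : A _⦋1⦌) :
    A.map (cut (n := n) (n + 1)).op z = degeneracy n A (A.δ 1 z) := by
  have h : cut (n := n) (n + 1) = SimplexCategory.const ⦋n⦌ ⦋0⦌ 0 ≫ SimplexCategory.δ 1 :=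
    hom_to_one_ext fun k => if_pos k.2
  rw [h, op_comp, A.map_comp]
  rfl

theorem mulBy_δ {n : ℕ} (w : A _⦋n + 1⦌) (j : Fin (n + 2)) :
    mulBy w ≫ (toAb.obj A).δ j = (toAb.obj A).δ j ≫ mulBy (A.δ j w) := mulBy_map _ _

theorem mulBy_σ {n : ℕ} (w : A _⦋n⦌) (j : Fin (n + 1)) :
    mulBy w ≫ (toAb.obj A).σ j = (toAb.obj A).σ j ≫ mulBy (A.σ j w) := mulBy_map _ _

/-- Multiplication by the two ends of an element of `A_1` are homotopic. -/
def mulHomotopy (z : A _⦋1⦌) : SimplicialObject.Homotopy (mulMap A (A.δ 1 z)) (mulMap A (A.δ 0 z))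
    where
  -- The prism operator is $h_i(x)=\theta_i^*z\cdot s_i x$, where $\theta_i:[n+1]\to[1]$ sends
  -- exactly $0,\dots,i$ to $0$; these are $i+1$ elements. The identities are those of the $s_i$
  -- together with the effect of cofaces and codegeneracies on the position of the cut.
  h {n} i := (toAb.obj A).σ i ≫ mulBy (A.map (cut (n := n + 1) (i + 1)).op z)
  h_zero_comp_δ_zero n := by
    rw [Category.assoc, mulBy_δ, ← Category.assoc, map_cut_δ A z 0 _ 0 (fun k => by simp),
      map_cut_zero]
    erw [(toAb.obj A).δ_comp_σ_self (i := 0), Category.id_comp]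
    rfl
  h_last_comp_δ_last n := by
    rw [Category.assoc, mulBy_δ, ← Category.assoc,
      map_cut_δ A z (Fin.last _) _ (n + 1) (fun k => by simp), map_cut_last]
    erw [(toAb.obj A).δ_comp_σ_succ (i := Fin.last n), Category.id_comp]
    rfl
  h_succ_comp_δ_castSucc_of_lt i j hij := by
    rw [Category.assoc, mulBy_δ, ← Category.assoc,
      map_cut_δ A z i.castSucc _ (j + 1) (fun k => by
        grind [Fin.succAbove, Fin.lt_def, Fin.le_def]),
      (toAb.obj A).δ_comp_σ_of_le hij, Category.assoc]
  h_succ_comp_δ_castSucc_succ j := by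
    rw [Category.assoc, mulBy_δ, ← Category.assoc, Category.assoc _ _ ((toAb.obj A).δ _), mulBy_δ,
      ← Category.assoc,
      map_cut_δ A z j.castSucc.succ _ (j + 1) (fun k => by
        grind [Fin.succAbove, Fin.lt_def, Fin.le_def]),
      map_cut_δ A z j.castSucc.succ _ (j + 1) (fun k => by
        grind [Fin.succAbove, Fin.lt_def, Fin.le_def])]
    have h₁ := (toAb.obj A).δ_comp_σ_self (i := j.succ)
    have h₂ := (toAb.obj A).δ_comp_σ_succ (i := j.castSucc)
    erw [h₁, h₂]
  h_castSucc_comp_δ_succ_of_lt i j hji := by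
    rw [Category.assoc, mulBy_δ, ← Category.assoc,
      map_cut_δ A z i.succ _ (j + 1) (fun k => by
        grind [Fin.succAbove, Fin.lt_def, Fin.le_def]),
      (toAb.obj A).δ_comp_σ_of_gt hji, Category.assoc]
  h_comp_σ_castSucc_of_le i j hij := by
    rw [Category.assoc, mulBy_σ, ← Category.assoc,
      map_cut_σ A z i.castSucc _ (j.succ + 1) (fun k => by
        rw [Fin.predAbove]
        split_ifs with h
        all_goals
          simp only [Fin.lt_def, Fin.le_def, Fin.val_castSucc, Fin.val_succ, Fin.val_pred,
            Fin.coe_castPred] at h hij ⊢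
          omega),
      (toAb.obj A).σ_comp_σ hij, Category.assoc]
  h_comp_σ_succ_of_lt i j hji := by
    rw [Category.assoc, mulBy_σ, ← Category.assoc,
      map_cut_σ A z i.succ _ (j + 1) (fun k => by
        rw [Fin.predAbove]
        split_ifs with h
        all_goals
          simp only [Fin.lt_def, Fin.le_def, Fin.val_castSucc, Fin.val_succ, Fin.val_pred,
            Fin.coe_castPred] at h hji ⊢
          try omega),
      ← (toAb.obj A).σ_comp_σ hji, Category.assoc]
    rfl

/-- Multiplication by the two ends of an element of `A_1` agree on homotopy groups. -/
theorem map_mulMap_eq (z : A _⦋1⦌) (k : ℕ) :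
    (AlgebraicTopology.alternatingFaceMapComplex AddCommGrpCat.{u} ⋙
      HomologicalComplex.homologyFunctor AddCommGrpCat.{u} _ k).map (mulMap A (A.δ 1 z)) =
    (AlgebraicTopology.alternatingFaceMapComplex AddCommGrpCat.{u} ⋙
      HomologicalComplex.homologyFunctor AddCommGrpCat.{u} _ k).map (mulMap A (A.δ 0 z)) :=
  (mulHomotopy A z).map_homology_eq k

end SCInftyRing

/-! ### Homology classes through their representatives -/

namespace HomologicalComplex

/-- The homology class `c` is represented by `x`. -/
def IsClass {ι : Type} {s : ComplexShape ι} (K : HomologicalComplex AddCommGrpCat.{u} s) (i : ι)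
    (x : K.X i) (c : K.homology i) : Prop :=
  ∃ z : K.cycles i, K.iCycles i z = x ∧ K.homologyπ i z = c

section

variable {ι : Type} {s : ComplexShape ι} {K L : HomologicalComplex AddCommGrpCat.{u} s} {i : ι}

theorem exists_isClass (c : K.homology i) : ∃ x, K.IsClass i x c := by
  obtain ⟨z, rfl⟩ := (AddCommGrpCat.epi_iff_surjective (K.homologyπ i)).1 inferInstance c
  exact ⟨_, z, rfl, rfl⟩

theorem exists_isClass_of_d_eq_zero {j : ι} (hj : s.next i = j) {x : K.X i}
    (hx : K.d i j x = 0) : ∃ c, K.IsClass i x c := by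
  have he := (ShortComplex.exact_of_f_is_kernel
    (ShortComplex.mk (K.iCycles i) (K.d i j) (K.iCycles_d i j)) (K.cyclesIsKernel i j hj))
  obtain ⟨z, hz⟩ := (ShortComplex.ab_exact_iff _).1 he x hx
  exact ⟨_, z, hz, rfl⟩

theorem IsClass.d_eq_zero {x : K.X i} {c : K.homology i} (h : K.IsClass i x c) (j : ι) :
    K.d i j x = 0 := by
  obtain ⟨z, rfl, -⟩ := h
  rw [← ConcreteCategory.comp_apply, K.iCycles_d]
  rfl

theorem IsClass.map {x : K.X i} {c : K.homology i} (h : K.IsClass i x c) (φ : K ⟶ L) :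
    L.IsClass i (φ.f i x) (homologyMap φ i c) := by
  obtain ⟨z, rfl, rfl⟩ := h
  refine ⟨cyclesMap φ i z, ?_, ?_⟩
  · rw [← ConcreteCategory.comp_apply, ← ConcreteCategory.comp_apply, cyclesMap_i]
  · rw [← ConcreteCategory.comp_apply, ← ConcreteCategory.comp_apply, homologyπ_naturality]

theorem IsClass.unique {x : K.X i} {c c' : K.homology i} (h : K.IsClass i x c)
    (h' : K.IsClass i x c') : c = c' := by
  obtain ⟨z, hz, rfl⟩ := h
  obtain ⟨z', hz', rfl⟩ := h'
  rw [(AddCommGrpCat.mono_iff_injective (K.iCycles i)).1 inferInstance (hz.trans hz'.symm)]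

theorem IsClass.eq_zero_iff {x : K.X i} {c : K.homology i} (h : K.IsClass i x c) {j : ι}
    (hj : s.prev i = j) : c = 0 ↔ ∃ y : K.X j, K.d j i y = x := by
  have he := (ShortComplex.exact_of_g_is_cokernel
    (ShortComplex.mk _ _ (K.toCycles_comp_homologyπ j i)) (K.homologyIsCokernel j i hj))
  rw [ShortComplex.ab_exact_iff] at he
  obtain ⟨z, rfl, rfl⟩ := h
  constructor
  · intro hz
    obtain ⟨y, rfl⟩ := he z hz
    exact ⟨y, by rw [← ConcreteCategory.comp_apply]; simp⟩
  · rintro ⟨y, hy⟩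
    have : z = K.toCycles j i y := (AddCommGrpCat.mono_iff_injective (K.iCycles i)).1 inferInstance
      (hy.symm.trans (by rw [← ConcreteCategory.comp_apply]; simp))
    rw [this, ← ConcreteCategory.comp_apply, K.toCycles_comp_homologyπ]
    rfl

end

end HomologicalComplex

namespace SCInftyRing

theorem degeneracy_zero (A : SCInftyRing.{u}) (a : A _⦋0⦌) : degeneracy 0 A a = a := by
  have : SimplexCategory.const ⦋0⦌ ⦋0⦌ 0 = 𝟙 _ := Subsingleton.elim _ _
  change A.map (SimplexCategory.const ⦋0⦌ ⦋0⦌ 0).op _ = _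
  rw [this, op_id, A.map_id]
  rfl

/-- The unnormalized chain complex. -/
def chains (A : SCInftyRing.{u}) : ChainComplex AddCommGrpCat.{u} ℕ :=
  (AlgebraicTopology.alternatingFaceMapComplex AddCommGrpCat.{u}).obj (toAb.obj A)

/-- Functoriality of the chain complex. -/
def chainsMap {A B : SCInftyRing.{u}} (φ : A ⟶ B) : A.chains ⟶ B.chains :=
  (AlgebraicTopology.alternatingFaceMapComplex AddCommGrpCat.{u}).map (toAb.map φ)

/-- The boundary `A_{n+1} → A_n`. -/
def bd (A : SCInftyRing.{u}) (n : ℕ) (x : A _⦋n + 1⦌) : A _⦋n⦌ := A.chains.d (n + 1) n x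

theorem app_bd {A B : SCInftyRing.{u}} (φ : A ⟶ B) (n : ℕ) (x : A _⦋n + 1⦌) :
    φ.app (op ⦋n⦌) (A.bd n x) = B.bd n (φ.app (op ⦋n + 1⦌) x) :=
  (ConcreteCategory.congr_hom ((chainsMap φ).comm (n + 1) n) x).symm

theorem bd_mul (A : SCInftyRing.{u}) (n : ℕ) (b : A _⦋0⦌) (x : A _⦋n + 1⦌) :
    A.bd n (degeneracy (n + 1) A b * x) = degeneracy n A b * A.bd n x :=
  ConcreteCategory.congr_hom (((AlgebraicTopology.alternatingFaceMapComplex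
    AddCommGrpCat.{u}).map (mulMap A b)).comm (n + 1) n) x

/-- The element `c` of `π_k(A)` is represented by `x`. -/
def IsClass (A : SCInftyRing.{u}) (k : ℕ) (x : A _⦋k⦌) (c : (homotopyGroup k).obj A) : Prop :=
  A.chains.IsClass k x c

variable {A B : SCInftyRing.{u}} {k : ℕ}

theorem exists_isClass (c : (homotopyGroup k).obj A) : ∃ x, A.IsClass k x c :=
  HomologicalComplex.exists_isClass (K := A.chains) c

theorem exists_isClass_of_bd {x : A _⦋k + 1⦌} (hx : A.bd k x = 0) :
    ∃ c, A.IsClass (k + 1) x c :=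
  HomologicalComplex.exists_isClass_of_d_eq_zero (K := A.chains) (by simp) hx

theorem IsClass.bd_eq_zero {x : A _⦋k + 1⦌} {c} (h : A.IsClass (k + 1) x c) : A.bd k x = 0 :=
  HomologicalComplex.IsClass.d_eq_zero h k

theorem IsClass.map {x : A _⦋k⦌} {c} (h : A.IsClass k x c) (φ : A ⟶ B) :
    B.IsClass k (φ.app (op ⦋k⦌) x) ((homotopyGroup k).map φ c) :=
  HomologicalComplex.IsClass.map h (chainsMap φ)

theorem IsClass.unique {x : A _⦋k⦌} {c c'} (h : A.IsClass k x c) (h' : A.IsClass k x c') :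
    c = c' :=
  HomologicalComplex.IsClass.unique h h'

theorem IsClass.eq_zero_iff {x : A _⦋k⦌} {c} (h : A.IsClass k x c) :
    c = 0 ↔ ∃ y, A.bd k y = x :=
  HomologicalComplex.IsClass.eq_zero_iff h (by simp)

/-- Multiplication by `δ 0 z` is homotopic to multiplication by `δ 1 z`, which is the identity, so
it does not change the class of a cycle. -/
theorem IsClass.mul {x : A _⦋k⦌} {c} (h : A.IsClass k x c) {z : A _⦋1⦌} (hz : A.δ 1 z = 1) :
    A.IsClass k (degeneracy k A (A.δ 0 z) * x) c := by
  have h0 := HomologicalComplex.IsClass.map h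
    ((AlgebraicTopology.alternatingFaceMapComplex AddCommGrpCat.{u}).map (mulMap A (A.δ 0 z)))
  have h1 := HomologicalComplex.IsClass.map h
    ((AlgebraicTopology.alternatingFaceMapComplex AddCommGrpCat.{u}).map (mulMap A (A.δ 1 z)))
  have e : A.IsClass k (degeneracy k A (A.δ 1 z) * x) c := by
    rw [hz, (degeneracy k A).map_one, one_mul]
    exact h
  have h2 := HomologicalComplex.IsClass.unique h1 e
  rw [← h2]
  have h3 := ConcreteCategory.congr_hom (map_mulMap_eq A z k) c
  have h4 : A.IsClass k (degeneracy k A (A.δ 0 z) * x) _ := h0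
  exact h3 ▸ h4

end SCInftyRing

/-! ### Local quotients induce isomorphisms of homotopy sheaves -/

/-- A morphism of spaces with presheaves of simplicial `C^∞`-rings that is a homeomorphism, locally
surjective on sections, and whose kernel is locally annihilated by elements of `O_0` homotopic
to `1`. -/
structure IsLocalQuotient {Y X : PresheafedSpace.{u} SCInftyRing.{u}} (f : Y ⟶ X) : Prop where
  isHomeomorph : IsHomeomorph f.base
  surj : ∀ (n : ℕ) (V : Opens X) (t : (Y.presheaf.obj (op ((Opens.map f.base).obj V))) _⦋n⦌),
    ∀ x ∈ V, ∃ (W : Opens X) (i : W ⟶ V) (s : (X.presheaf.obj (op W)) _⦋n⦌), x ∈ W ∧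
      (f.c.app (op W)).app (op ⦋n⦌) s =
        (Y.presheaf.map ((Opens.map f.base).map i).op).app (op ⦋n⦌) t
  ker : ∀ (n : ℕ) (V : Opens X) (s s' : (X.presheaf.obj (op V)) _⦋n⦌),
    (f.c.app (op V)).app (op ⦋n⦌) s = (f.c.app (op V)).app (op ⦋n⦌) s' →
    ∀ x ∈ V, ∃ (W : Opens X) (i : W ⟶ V) (z : (X.presheaf.obj (op W)) _⦋1⦌), x ∈ W ∧
      (X.presheaf.obj (op W)).δ 1 z = 1 ∧
      SCInftyRing.degeneracy n _ ((X.presheaf.obj (op W)).δ 0 z) *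
          (X.presheaf.map i.op).app (op ⦋n⦌) s =
        SCInftyRing.degeneracy n _ ((X.presheaf.obj (op W)).δ 0 z) *
          (X.presheaf.map i.op).app (op ⦋n⦌) s'

namespace IsLocalQuotient

variable {Y X : PresheafedSpace.{u} SCInftyRing.{u}} {f : Y ⟶ X}

theorem app_res (f : Y ⟶ X) {V W : Opens X} (i : W ⟶ V) {n : ℕ}
    (s : (X.presheaf.obj (op V)) _⦋n⦌) :
    (f.c.app (op W)).app (op ⦋n⦌) ((X.presheaf.map i.op).app (op ⦋n⦌) s) =
      (Y.presheaf.map ((Opens.map f.base).map i).op).app (op ⦋n⦌)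
        ((f.c.app (op V)).app (op ⦋n⦌) s) :=
  ConcreteCategory.congr_hom (congr_app (f.c.naturality i.op) (op ⦋n⦌)) s

theorem app_δ {A B : SCInftyRing.{u}} (φ : A ⟶ B) {n : ℕ} (j : Fin (n + 2)) (x : A _⦋n + 1⦌) :
    φ.app (op ⦋n⦌) (A.δ j x) = B.δ j (φ.app (op ⦋n + 1⦌) x) :=
  ConcreteCategory.congr_hom (φ.naturality (SimplexCategory.δ j).op) x

theorem app_degeneracy {A B : SCInftyRing.{u}} (φ : A ⟶ B) (n : ℕ) (x : A _⦋0⦌) :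
    φ.app (op ⦋n⦌) (SCInftyRing.degeneracy n A x) =
      SCInftyRing.degeneracy n B (φ.app (op ⦋0⦌) x) :=
  ConcreteCategory.congr_hom (φ.naturality (SimplexCategory.const ⦋n⦌ ⦋0⦌ 0).op) x

theorem app_res_res (X : PresheafedSpace.{u} SCInftyRing.{u}) {V W W' : Opens X} (i : W ⟶ V)
    (j : W' ⟶ W) {n : ℕ} (s : (X.presheaf.obj (op V)) _⦋n⦌) :
    (X.presheaf.map j.op).app (op ⦋n⦌) ((X.presheaf.map i.op).app (op ⦋n⦌) s) =
      (X.presheaf.map (j ≫ i).op).app (op ⦋n⦌) s := by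
  rw [op_comp, X.presheaf.map_comp]
  rfl

/-- If the image of a cycle $a$ is $\partial y$, lift $y$ locally to $y'$. Then $a$ and $\partial
y'$ have the same image, so $wa=w\,\partial y'=\partial(wy')$ for some $w$ homotopic to $1$, and
$wa$ still represents the class of $a$. -/
theorem homotopyGroup_isLocallyInj (hf : IsLocalQuotient f) (k : ℕ) :
    PresheafedSpace.IsLocallyInj
      ((SCInftyRing.homotopyGroup (k + 1) ⋙ forget AddCommGrpCat.{u}).mapPresheaf.map f) := by
  have key : ∀ (V : Opens X) (c : (SCInftyRing.homotopyGroup (k + 1)).obj (X.presheaf.obj (op V))),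
      (SCInftyRing.homotopyGroup (k + 1)).map (f.c.app (op V)) c = 0 → ∀ x ∈ V,
      ∃ (W : Opens X) (i : W ⟶ V), x ∈ W ∧
        (SCInftyRing.homotopyGroup (k + 1)).map (X.presheaf.map i.op) c = 0 := by
    intro V c hc x hx
    obtain ⟨a, ha⟩ := SCInftyRing.exists_isClass c
    obtain ⟨y, hy⟩ := (ha.map (f.c.app (op V))).eq_zero_iff.1 hc
    obtain ⟨W, i, y', hxW, hy'⟩ := hf.surj _ V y x hx
    have h1 : (f.c.app (op W)).app (op ⦋k + 1⦌) ((X.presheaf.map i.op).app (op ⦋k + 1⦌) a) =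
        (f.c.app (op W)).app (op ⦋k + 1⦌) (SCInftyRing.bd _ _ y') := by
      rw [app_res, SCInftyRing.app_bd, hy', ← hy]
      exact SCInftyRing.app_bd _ _ _
    obtain ⟨W', j, z, hxW', hz, h2⟩ := hf.ker _ _ _ _ h1 x hxW
    refine ⟨W', j ≫ i, hxW', ((ha.map (X.presheaf.map (j ≫ i).op)).mul hz).eq_zero_iff.2 ?_⟩
    rw [← app_res_res, h2, SCInftyRing.app_bd, ← SCInftyRing.bd_mul]
    exact ⟨_, rfl⟩
  intro (V : Opens X) (s : (SCInftyRing.homotopyGroup (k + 1)).obj (X.presheaf.obj (op V)))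
    (t : (SCInftyRing.homotopyGroup (k + 1)).obj (X.presheaf.obj (op V))) hst (x : X) (hx : x ∈ V)
  have h0 : (SCInftyRing.homotopyGroup (k + 1)).map (f.c.app (op V)) (s - t) = 0 := by
    rw [map_sub, sub_eq_zero]
    exact hst
  obtain ⟨W, i, hxW, h⟩ := key V (s - t) h0 x hx
  rw [map_sub, sub_eq_zero] at h
  exact ⟨W, i, hxW, h⟩

/-- Lift a cycle $y$ locally to a chain $a$. Its boundary has image zero, so $w\,\partial a=0$ for
some $w$ homotopic to $1$. Then $wa$ is a cycle, and its image, $y$ times the image of $w$,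
represents the class of $y$. -/
theorem homotopyGroup_isLocallySurj (hf : IsLocalQuotient f) (k : ℕ) :
    PresheafedSpace.IsLocallySurj
      ((SCInftyRing.homotopyGroup (k + 1) ⋙ forget AddCommGrpCat.{u}).mapPresheaf.map f) := by
  intro (V : Opens X)
    (c : (SCInftyRing.homotopyGroup (k + 1)).obj (Y.presheaf.obj (op ((Opens.map f.base).obj V))))
    (x : X) (hx : x ∈ V)
  obtain ⟨y, hy⟩ := SCInftyRing.exists_isClass (k := k + 1)
    (A := Y.presheaf.obj (op ((Opens.map f.base).obj V))) c
  obtain ⟨W, i, a, hxW, ha⟩ := hf.surj _ V y x hx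
  have h1 : (f.c.app (op W)).app (op ⦋k⦌) (SCInftyRing.bd _ _ a) =
      (f.c.app (op W)).app (op ⦋k⦌) 0 := by
    rw [SCInftyRing.app_bd, ha, CInftyHom.map_zero]
    refine (SCInftyRing.app_bd _ _ _).symm.trans ?_
    rw [hy.bd_eq_zero, CInftyHom.map_zero]
  obtain ⟨W', j, z, hxW', hz, h2⟩ := hf.ker _ _ _ _ h1 x hxW
  rw [SCInftyRing.app_bd, ← SCInftyRing.bd_mul, CInftyHom.map_zero, mul_zero] at h2
  obtain ⟨c', hc'⟩ := SCInftyRing.exists_isClass_of_bd h2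
  refine ⟨W', j ≫ i, c', hxW', ?_⟩
  have h3 := hc'.map (f.c.app (op W'))
  have hz' : (Y.presheaf.obj (op ((Opens.map f.base).obj W'))).δ 1
      ((f.c.app (op W')).app (op ⦋1⦌) z) = 1 := by
    refine (app_δ (f.c.app (op W')) 1 z).symm.trans ?_
    rw [hz, CInftyHom.map_one]
  have h4 := (hy.map (Y.presheaf.map ((Opens.map f.base).map (j ≫ i)).op)).mul hz'
  have e : (f.c.app (op W')).app (op ⦋k + 1⦌)
      (SCInftyRing.degeneracy (k + 1) _ ((X.presheaf.obj (op W')).δ 0 z) *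
        (X.presheaf.map j.op).app (op ⦋k + 1⦌) a) =
      SCInftyRing.degeneracy (k + 1) _ ((Y.presheaf.obj (op ((Opens.map f.base).obj W'))).δ 0
        ((f.c.app (op W')).app (op ⦋1⦌) z)) *
        (Y.presheaf.map ((Opens.map f.base).map (j ≫ i)).op).app (op ⦋k + 1⦌) y := by
    rw [CInftyHom.map_mul, app_degeneracy, app_δ, app_res, ha]
    exact congrArg _ (app_res_res Y ((Opens.map f.base).map i) ((Opens.map f.base).map j) y)
  rw [e] at h3
  exact h3.unique h4

/-- A $1$-simplex joining the images of $a$ and $b$ lifts locally. The ends of the lift agree with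
$a$ and $b$ after multiplication by elements homotopic to $1$, and these equal $1$ in $\pi_0$. -/
theorem piZero_isLocallyInj (hf : IsLocalQuotient f) :
    PresheafedSpace.IsLocallyInj
      ((SCInftyRing.piZero ⋙ forget CInftyRingCat.{u}).mapPresheaf.map f) := by
  intro (V : Opens X) (s : (X.presheaf.obj (op V)).PiZero) (t : (X.presheaf.obj (op V)).PiZero) hst
    (x : X) (hx : x ∈ V)
  obtain ⟨a, rfl⟩ := SCInftyRing.PiZero.mk_surjective _ s
  obtain ⟨b, rfl⟩ := SCInftyRing.PiZero.mk_surjective _ t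
  obtain ⟨y, hya, hyb⟩ : ∃ z, (Y.presheaf.obj (op ((Opens.map f.base).obj V))).δ 0 z =
      (f.c.app (op V)).app (op ⦋0⦌) a ∧ (Y.presheaf.obj (op ((Opens.map f.base).obj V))).δ 1 z =
      (f.c.app (op V)).app (op ⦋0⦌) b :=
    Quotient.exact (s := (Y.presheaf.obj (op ((Opens.map f.base).obj V))).congr) hst
  obtain ⟨W, i, y', hxW, hy'⟩ := hf.surj _ V y x hx
  have mk_eq : ∀ (A : SCInftyRing.{u}) (z : A _⦋1⦌), A.δ 1 z = 1 → ∀ a a' : A _⦋0⦌,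
      SCInftyRing.degeneracy 0 _ (A.δ 0 z) * a = SCInftyRing.degeneracy 0 _ (A.δ 0 z) * a' →
      SCInftyRing.PiZero.mk A a = SCInftyRing.PiZero.mk A a' := by
    intro A z hz a a' h
    rw [SCInftyRing.degeneracy_zero] at h
    let p : CInftyHom (A _⦋0⦌) A.PiZero := SCInftyRing.toPiZero.app A
    have h1 : p (A.δ 0 z) = 1 := by
      rw [← p.map_one]
      exact Quotient.sound (s := A.congr) ⟨z, rfl, hz⟩
    have h2 := congrArg p h
    rw [p.map_mul, p.map_mul, h1, one_mul, one_mul] at h2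
    exact h2
  have step : ∀ (j : Fin 2) (c : (X.presheaf.obj (op V)) _⦋0⦌),
      (Y.presheaf.obj (op ((Opens.map f.base).obj V))).δ j y =
        (f.c.app (op V)).app (op ⦋0⦌) c → ∃ (W' : Opens X) (k : W' ⟶ W), x ∈ W' ∧
        SCInftyRing.PiZero.mk _ ((X.presheaf.map (k ≫ i).op).app (op ⦋0⦌) c) =
        SCInftyRing.PiZero.mk _ ((X.presheaf.map k.op).app (op ⦋0⦌)
          ((X.presheaf.obj (op W)).δ j y')) := by
    intro j c hc
    have h1 : (f.c.app (op W)).app (op ⦋0⦌) ((X.presheaf.map i.op).app (op ⦋0⦌) c) =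
        (f.c.app (op W)).app (op ⦋0⦌) ((X.presheaf.obj (op W)).δ j y') := by
      rw [app_res, ← hc, app_δ, ← hy']
      exact (app_δ _ _ _).symm
    obtain ⟨W', k, z, hxW', hz, h2⟩ := hf.ker _ _ _ _ h1 x hxW
    rw [app_res_res] at h2
    exact ⟨W', k, hxW', mk_eq _ z hz _ _ h2⟩
  -- The two ends are corrected on different neighbourhoods, so both comparisons are restricted to
  -- the intersection before they are joined by the lifted simplex.
  obtain ⟨W₀, k₀, hx₀, h₀⟩ := step 0 a hya
  obtain ⟨W₁, k₁, hx₁, h₁⟩ := step 1 b hyb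
  let W' : Opens X := W₀ ⊓ W₁
  let l₀ : W' ⟶ W₀ := homOfLE inf_le_left
  let l₁ : W' ⟶ W₁ := homOfLE inf_le_right
  have res : ∀ {W₂ : Opens X} (l : W' ⟶ W₂) (k : W₂ ⟶ W) (c : (X.presheaf.obj (op V)) _⦋0⦌)
      (d : (X.presheaf.obj (op W)) _⦋0⦌),
      SCInftyRing.PiZero.mk _ ((X.presheaf.map (k ≫ i).op).app (op ⦋0⦌) c) =
        SCInftyRing.PiZero.mk _ ((X.presheaf.map k.op).app (op ⦋0⦌) d) →
      SCInftyRing.PiZero.mk _ ((X.presheaf.map ((l₀ ≫ k₀) ≫ i).op).app (op ⦋0⦌) c) =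
        SCInftyRing.PiZero.mk _ ((X.presheaf.map (l₀ ≫ k₀).op).app (op ⦋0⦌) d) := by
    intro W₂ l k c d h
    have h2 := congrArg (SCInftyRing.piZero.map (X.presheaf.map l.op)) h
    have e1 : (l₀ ≫ k₀) ≫ i = l ≫ k ≫ i := Subsingleton.elim _ _
    have e2 : l₀ ≫ k₀ = l ≫ k := Subsingleton.elim _ _
    rw [e1, e2, ← app_res_res X (k ≫ i) l, ← app_res_res X k l]
    exact h2
  refine ⟨W', (l₀ ≫ k₀) ≫ i, ⟨hx₀, hx₁⟩, ?_⟩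
  refine (res l₀ k₀ _ _ h₀).trans (Eq.trans ?_ (res l₁ k₁ _ _ h₁).symm)
  refine Quotient.sound (s := (X.presheaf.obj (op W')).congr)
    ⟨(X.presheaf.map (l₀ ≫ k₀).op).app (op ⦋1⦌) y', ?_, ?_⟩
  · exact (app_δ _ _ _).symm
  · exact (app_δ _ _ _).symm

theorem piZero_isLocallySurj (hf : IsLocalQuotient f) :
    PresheafedSpace.IsLocallySurj
      ((SCInftyRing.piZero ⋙ forget CInftyRingCat.{u}).mapPresheaf.map f) := by
  intro (V : Opens X) (t : (Y.presheaf.obj (op ((Opens.map f.base).obj V))).PiZero) (x : X)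
    (hx : x ∈ V)
  obtain ⟨y, rfl⟩ := SCInftyRing.PiZero.mk_surjective _ t
  obtain ⟨W, i, a, hxW, ha⟩ := hf.surj _ V y x hx
  exact ⟨W, i, SCInftyRing.PiZero.mk _ a, hxW, congrArg (SCInftyRing.PiZero.mk _) ha⟩

end IsLocalQuotient

namespace IsLocalQuotient

variable {Y X : PresheafedSpace.{u} SCInftyRing.{u}} {f : Y ⟶ X}

/-- The morphism induced on the presheaves `U ↦ π_0(Γ(U, O_•))`. -/
def piZeroMap (f : Y ⟶ X) : (⟨Y.carrier, piZeroPresheaf Y⟩ : PresheafedSpace CInftyRingCat.{u}) ⟶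
    ⟨X.carrier, piZeroPresheaf X⟩ :=
  SCInftyRing.piZero.mapPresheaf.map f

/-- The morphism induced on the stalks of `π_0(O_•)`. -/
def piZeroStalkMap (f : Y ⟶ X) (y : Y) :
    CInftyHom ((piZeroPresheaf X).CStalk (f.base y)) ((piZeroPresheaf Y).CStalk y) :=
  PresheafedSpace.cstalkMap (piZeroMap f) y

/-- The morphism of `C^∞`-rings induced on sections of the associated sheaves. -/
def sectionsHom (f : Y ⟶ X) (Z : Set X) :
    CInftyHom ((piZeroPresheaf X).sets.Sections Z)
      ((piZeroPresheaf Y).sets.Sections (f.base ⁻¹' Z)) where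
  toFun := PresheafedSpace.Hom.sectionsMap
    ((SCInftyRing.piZero ⋙ forget CInftyRingCat.{u}).mapPresheaf.map f) Z
  map_op k a := TopCat.Presheaf.Sections.ext (funext fun z : (f.base ⁻¹' Z : Set Y) =>
    (piZeroStalkMap f (z.1 : Y)).op_apply k
      fun i => (a i).val ⟨f.base z.1, z.2⟩)

theorem piZero_stalkMap_bijective (hf : IsLocalQuotient f) (y : Y) : Function.Bijective
    (((SCInftyRing.piZero ⋙ forget CInftyRingCat.{u}).mapPresheaf.map f).stalkMap y) :=
  PresheafedSpace.stalkMap_bijective hf.isHomeomorph hf.piZero_isLocallyInj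
    hf.piZero_isLocallySurj y

theorem sectionsHom_bijective (hf : IsLocalQuotient f) (Z : Set X) :
    Function.Bijective (sectionsHom f Z) :=
  PresheafedSpace.sectionsMap_bijective
    (g := (SCInftyRing.piZero ⋙ forget CInftyRingCat.{u}).mapPresheaf.map f)
    hf.isHomeomorph hf.piZero_stalkMap_bijective Z

/-- All the conditions concern only the space and the sheaf associated to $\pi_0$, so they are
transported along the homeomorphism and the bijections on sections and stalks. -/
theorem isCInftySpace (hf : IsLocalQuotient f) (hX : IsCInftySpace (piZeroPresheaf X)) :
    IsCInftySpace (piZeroPresheaf Y) where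
  t2 := by
    have := hX.t2
    exact hf.isHomeomorph.isEmbedding.t2Space
  soft Z hZ s := by
    obtain ⟨Z', hZ', rfl⟩ : ∃ Z' : Set X, IsClosed Z' ∧ f.base ⁻¹' Z' = Z :=
      ⟨f.base '' Z, hf.isHomeomorph.isClosedMap _ hZ,
        Set.preimage_image_eq _ hf.isHomeomorph.injective⟩
    obtain ⟨s', rfl⟩ := (hf.sectionsHom_bijective Z').2 s
    obtain ⟨t, rfl⟩ := hX.soft Z' hZ' s'
    exact ⟨sectionsHom f Set.univ t, rfl⟩
  finGen U := by
    obtain ⟨V, rfl⟩ : ∃ V : Opens X, U = (Opens.map f.base).obj V :=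
      ⟨⟨f.base '' U, hf.isHomeomorph.isOpenMap _ U.isOpen⟩,
        Opens.ext (Set.preimage_image_eq _ hf.isHomeomorph.injective).symm⟩
    exact (hX.finGen V).of_surjective (sectionsHom f (V : Set X)) (hf.sectionsHom_bijective V).2
  isLocal y := (hX.isLocal (f.base y)).of_bijective
    (piZeroStalkMap f y) (hf.piZero_stalkMap_bijective y)

end IsLocalQuotient

theorem IsLocalQuotient.isLocalWeakEquivalence {X Y : SCInftySpace.{u}} {f : Y ⟶ X}
    (hf : IsLocalQuotient f.hom) : IsLocalWeakEquivalence f where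
  isHomeomorph := hf.isHomeomorph
  piZero V := hf.sectionsHom_bijective V
  homotopyGroup k hk V := by
    obtain ⟨k, rfl⟩ := Nat.exists_eq_succ_of_ne_zero (Nat.one_le_iff_ne_zero.1 hk)
    exact PresheafedSpace.sectionsMap_bijective
      (g := (SCInftyRing.homotopyGroup (k + 1) ⋙ forget AddCommGrpCat.{u}).mapPresheaf.map f.hom)
      hf.isHomeomorph
      (PresheafedSpace.stalkMap_bijective hf.isHomeomorph (hf.homotopyGroup_isLocallyInj k)
        (hf.homotopyGroup_isLocallySurj k)) (V : Set X.obj)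

/-! ### Values of sections and trivial germs -/

namespace SCInftySpace

variable (X : SCInftySpace.{u})

/-- The value at a point as a morphism of `C^∞`-rings. -/
def valueHom (p : X.obj) : CInftyHom ((levelPresheaf 0 X.obj).CStalk p) ℝ :=
  (X.property.isCInftySpace.isLocal p).residue.comp
    (TopCat.Presheaf.cstalkHom (F := levelPresheaf 0 X.obj) (G := piZeroPresheaf X.obj)
      (Functor.whiskerLeft X.obj.presheaf SCInftyRing.toPiZero) p)

/-- The value of a section of `O_0` at a point. -/
def valueAt {U : Opens X.obj} (b : (X.obj.presheaf.obj (op U)) _⦋0⦌) (p : X.obj) (hp : p ∈ U) : ℝ :=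
  X.valueHom p ((levelPresheaf 0 X.obj).cgerm U p hp b)

variable {X}

theorem valueAt_eq {U : Opens X.obj} (b : (X.obj.presheaf.obj (op U)) _⦋0⦌) (p : X.obj)
    (hp : p ∈ U) : X.valueAt b p hp = (X.property.isCInftySpace.isLocal p).residue
      ((piZeroPresheaf X.obj).cgerm U p hp (SCInftyRing.PiZero.mk _ b)) :=
  congrArg _ (TopCat.Presheaf.cstalkHom_cgerm (F := levelPresheaf 0 X.obj)
    (G := piZeroPresheaf X.obj) (Functor.whiskerLeft X.obj.presheaf SCInftyRing.toPiZero) U p hp b)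

theorem valueAt_res {U V : Opens X.obj} (i : V ⟶ U) (b : (X.obj.presheaf.obj (op U)) _⦋0⦌)
    (p : X.obj) (hp : p ∈ V) :
    X.valueAt ((X.obj.presheaf.map i.op).app (op ⦋0⦌) b) p hp = X.valueAt b p (i.le hp) :=
  congrArg (X.valueHom p) ((levelPresheaf 0 X.obj).cgerm_res i p hp b)

theorem valueAt_mul {U : Opens X.obj} (b c : (X.obj.presheaf.obj (op U)) _⦋0⦌) (p : X.obj)
    (hp : p ∈ U) : X.valueAt (b * c) p hp = X.valueAt b p hp * X.valueAt c p hp :=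
  ((X.valueHom p).comp ((levelPresheaf 0 X.obj).germHom U p hp)).map_mul b c

theorem valueAt_one {U : Opens X.obj} (p : X.obj) (hp : p ∈ U) :
    X.valueAt (1 : (X.obj.presheaf.obj (op U)) _⦋0⦌) p hp = 1 :=
  ((X.valueHom p).comp ((levelPresheaf 0 X.obj).germHom U p hp)).map_one

theorem valueAt_op {U : Opens X.obj} (k : SmoothFun 1) (b : (X.obj.presheaf.obj (op U)) _⦋0⦌)
    (p : X.obj) (hp : p ∈ U) :
    X.valueAt (CInftyRing.op k ![b]) p hp = k.1 ![X.valueAt b p hp] :=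
  ((X.valueHom p).comp ((levelPresheaf 0 X.obj).germHom U p hp)).op_apply_one k b

/-- A section of `O_0` that does not vanish at a point is invertible up to homotopy near it. -/
theorem exists_homotopy_inverse {U : Opens X.obj} (b : (X.obj.presheaf.obj (op U)) _⦋0⦌)
    {p : X.obj} (hp : p ∈ U) (hb : X.valueAt b p hp ≠ 0) :
    ∃ (W : Opens X.obj) (i : W ⟶ U) (c : (X.obj.presheaf.obj (op W)) _⦋0⦌)
      (z : (X.obj.presheaf.obj (op W)) _⦋1⦌), p ∈ W ∧
      (X.obj.presheaf.obj (op W)).δ 0 z = c * (X.obj.presheaf.map i.op).app (op ⦋0⦌) b ∧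
      (X.obj.presheaf.obj (op W)).δ 1 z = 1 := by
  rw [valueAt_eq] at hb
  -- The class of `b` is a unit in the local stalk of $\pi_0$. An inverse and the relation it
  -- satisfies extend to a neighbourhood, where equality in $\pi_0$ is witnessed by an element of
  -- $\mathcal O_1$.
  obtain ⟨e, he⟩ := ((X.property.isCInftySpace.isLocal p).isUnit_of_residue_ne_zero
    hb).exists_left_inv
  obtain ⟨V, hV, c', rfl⟩ := (piZeroPresheaf X.obj).exists_cgerm_eq e
  obtain ⟨c, rfl⟩ := SCInftyRing.PiZero.mk_surjective _ c'
  let W : Opens X.obj := U ⊓ V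
  let i : W ⟶ U := homOfLE inf_le_left
  let j : W ⟶ V := homOfLE inf_le_right
  have hW : p ∈ W := ⟨hp, hV⟩
  let π (W : Opens X.obj) : CInftyHom ((X.obj.presheaf.obj (op W)) _⦋0⦌)
    ((piZeroPresheaf X.obj).obj (op W)) := SCInftyRing.toPiZero.app (X.obj.presheaf.obj (op W))
  have h1 : (piZeroPresheaf X.obj).cgerm W p hW
      (π W ((X.obj.presheaf.map j.op).app (op ⦋0⦌) c * (X.obj.presheaf.map i.op).app (op ⦋0⦌) b)) =
      (piZeroPresheaf X.obj).cgerm W p hW (π W 1) := by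
    rw [(π W).map_mul, TopCat.Presheaf.cgerm_mul, (π W).map_one]
    refine Eq.trans (congrArg₂ (· * ·) ((piZeroPresheaf X.obj).cgerm_res j p hW
      (SCInftyRing.PiZero.mk _ c))
      ((piZeroPresheaf X.obj).cgerm_res i p hW
      (SCInftyRing.PiZero.mk _ b))) (he.trans ?_)
    exact ((piZeroPresheaf X.obj).germHom W p hW).map_one.symm
  obtain ⟨W', hW', k, l, hkl⟩ := TopCat.Presheaf.exists_res_eq_of_cgerm_eq _ h1
  obtain ⟨z, hz0, hz1⟩ : ∃ z, (X.obj.presheaf.obj (op W')).δ 0 z =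
      (X.obj.presheaf.map k.op).app (op ⦋0⦌) ((X.obj.presheaf.map j.op).app (op ⦋0⦌) c *
        (X.obj.presheaf.map i.op).app (op ⦋0⦌) b) ∧ (X.obj.presheaf.obj (op W')).δ 1 z =
      (X.obj.presheaf.map l.op).app (op ⦋0⦌) 1 :=
    Quotient.exact (s := (X.obj.presheaf.obj (op W')).congr) hkl
  rw [CInftyHom.map_mul, IsLocalQuotient.app_res_res, IsLocalQuotient.app_res_res] at hz0
  rw [CInftyHom.map_one] at hz1
  exact ⟨W', k ≫ i, _, z, hW', hz0, hz1⟩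

/-- Nonvanishing is an open condition. -/
theorem exists_forall_valueAt_ne_zero {U : Opens X.obj} (b : (X.obj.presheaf.obj (op U)) _⦋0⦌)
    {p : X.obj} (hp : p ∈ U) (hb : X.valueAt b p hp ≠ 0) :
    ∃ (W : Opens X.obj) (i : W ⟶ U), p ∈ W ∧
      ∀ (q : X.obj) (hq : q ∈ W), X.valueAt b q (i.le hq) ≠ 0 := by
  obtain ⟨W, i, c, z, hW, h0, h1⟩ := exists_homotopy_inverse b hp hb
  refine ⟨W, i, hW, fun q hq h => ?_⟩
  -- The ends $cb$ and $1$ of `z` have the same class in $\pi_0$ and hence the same value, so `b`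
  -- cannot vanish at `q`.
  have h2 : X.valueAt ((X.obj.presheaf.obj (op W)).δ 0 z) q hq =
      X.valueAt ((X.obj.presheaf.obj (op W)).δ 1 z) q hq := by
    rw [valueAt_eq, valueAt_eq]
    have : SCInftyRing.PiZero.mk _ ((X.obj.presheaf.obj (op W)).δ 0 z) =
      SCInftyRing.PiZero.mk _ ((X.obj.presheaf.obj (op W)).δ 1 z) :=
      Quotient.sound (s := (X.obj.presheaf.obj (op W)).congr) ⟨z, rfl, rfl⟩
    rw [this]
  rw [h0, h1, valueAt_mul, valueAt_res, h, mul_zero, valueAt_one] at h2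
  exact zero_ne_one h2

/-- The kernel is the same for every localization, and `LocAt` supplies one. -/
theorem isTrivialGerm_iff {p : X.obj} (a : (levelPresheaf 0 X.obj).CStalk p) :
    X.IsTrivialGerm p a ↔ ∃ b, X.valueHom p b ≠ 0 ∧ b * a = 0 := by
  constructor
  · rintro ⟨B, _, ℓ, hℓ, ha⟩
    exact (IsCInftyLocalization.apply_eq_zero_iff (χ := X.valueHom p) hℓ a).1 ha
  · intro h
    exact ⟨_, _, _, LocAt.isCInftyLocalization (X.valueHom p),
      ((LocAt.isCInftyLocalization (X.valueHom p)).apply_eq_zero_iff a).2 h⟩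

end SCInftySpace

/-! ### The quotient sheaf as families of localized germs -/

namespace SCInftySpace

variable (X : SCInftySpace.{u})

/-- The presheaf `O_n`, for `n` an object of the simplex category. -/
abbrev simplexPresheaf (Δ : SimplexCategoryᵒᵖ) : TopCat.Presheaf CInftyRingCat.{u} X.obj.carrier :=
  X.obj.presheaf ⋙ (evaluation SimplexCategoryᵒᵖ CInftyRingCat.{u}).obj Δ

/-- The morphisms between the presheaves `O_n`. -/
def simplexMap {Δ Δ' : SimplexCategoryᵒᵖ} (θ : Δ ⟶ Δ') :
    X.simplexPresheaf Δ ⟶ X.simplexPresheaf Δ' :=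
  Functor.whiskerLeft X.obj.presheaf ((evaluation SimplexCategoryᵒᵖ CInftyRingCat.{u}).map θ)

/-- The map induced on stalks by a simplicial operator. -/
def simplexStalkMap {Δ Δ' : SimplexCategoryᵒᵖ} (θ : Δ ⟶ Δ') (p : X.obj) :
    CInftyHom ((X.simplexPresheaf Δ).CStalk p) ((X.simplexPresheaf Δ').CStalk p) :=
  TopCat.Presheaf.cstalkHom (X.simplexMap θ) p

theorem simplexStalkMap_cgerm {Δ Δ' : SimplexCategoryᵒᵖ} (θ : Δ ⟶ Δ') {U : Opens X.obj} (p : X.obj)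
    (hp : p ∈ U) (s : (X.obj.presheaf.obj (op U)).obj Δ) :
    X.simplexStalkMap θ p ((X.simplexPresheaf Δ).cgerm U p hp s) =
      (X.simplexPresheaf Δ').cgerm U p hp ((X.obj.presheaf.obj (op U)).map θ s) :=
  TopCat.Presheaf.cstalkHom_cgerm (X.simplexMap θ) U p hp s

/-- The degeneracies on stalks. -/
def degeneracyStalk (Δ : SimplexCategoryᵒᵖ) (p : X.obj) :
    CInftyHom ((levelPresheaf 0 X.obj).CStalk p) ((X.simplexPresheaf Δ).CStalk p) :=
  X.simplexStalkMap (SimplexCategory.const Δ.unop ⦋0⦌ 0).op p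

theorem degeneracyStalk_cgerm (Δ : SimplexCategoryᵒᵖ) {U : Opens X.obj} (p : X.obj)
    (hp : p ∈ U) (b : (X.obj.presheaf.obj (op U)) _⦋0⦌) :
    X.degeneracyStalk Δ p ((levelPresheaf 0 X.obj).cgerm U p hp b) =
      (X.simplexPresheaf Δ).cgerm U p hp
        ((X.obj.presheaf.obj (op U)).map (SimplexCategory.const Δ.unop ⦋0⦌ 0).op b) :=
  X.simplexStalkMap_cgerm _ p hp b

/-- As $[0]$ is terminal, the simplicial operators on stalks are linear over the stalk of $\mathcal
O_0$. This is what lets them descend to the localized stalks. -/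
theorem simplexStalkMap_degeneracyStalk {Δ Δ' : SimplexCategoryᵒᵖ} (θ : Δ ⟶ Δ') (p : X.obj)
    (b : (levelPresheaf 0 X.obj).CStalk p) :
    X.simplexStalkMap θ p (X.degeneracyStalk Δ p b) = X.degeneracyStalk Δ' p b := by
  obtain ⟨U, hU, b, rfl⟩ := (levelPresheaf 0 X.obj).exists_cgerm_eq b
  refine (congrArg _ (X.degeneracyStalk_cgerm Δ p hU b)).trans
    (Eq.trans ?_ (X.degeneracyStalk_cgerm Δ' p hU b).symm)
  rw [simplexStalkMap_cgerm]
  refine congrArg _ ?_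
  change ((X.obj.presheaf.obj (op U)).map _ ≫ (X.obj.presheaf.obj (op U)).map θ) b = _
  rw [← Functor.map_comp]
  rfl

/-- The localization of the stalk of `O_n` at a point. -/
abbrev Fiber (Δ : SimplexCategoryᵒᵖ) (p : X.obj) : Type u :=
  LocAt (X.degeneracyStalk Δ p) (X.valueHom p)

/-- The element of the localized stalk defined by a section. -/
def fiberHom (Δ : SimplexCategoryᵒᵖ) {U : Opens X.obj} (p : X.obj) (hp : p ∈ U) :
    CInftyHom ((X.obj.presheaf.obj (op U)).obj Δ) (X.Fiber Δ p) :=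
  (LocAt.proj _ _).comp ((X.simplexPresheaf Δ).germHom U p hp)

theorem fiberHom_res (Δ : SimplexCategoryᵒᵖ) {U V : Opens X.obj} (i : V ⟶ U) (p : X.obj)
    (hp : p ∈ V) (s : (X.obj.presheaf.obj (op U)).obj Δ) :
    X.fiberHom Δ p hp ((X.obj.presheaf.map i.op).app Δ s) = X.fiberHom Δ p (i.le hp) s :=
  congrArg (LocAt.mk _ _) ((X.simplexPresheaf Δ).cgerm_res i p hp s)

/-- The map induced on localized stalks by a simplicial operator. -/
def fiberMap {Δ Δ' : SimplexCategoryᵒᵖ} (θ : Δ ⟶ Δ') (p : X.obj) :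
    CInftyHom (X.Fiber Δ p) (X.Fiber Δ' p) :=
  LocAt.map (X.simplexStalkMap θ p) (X.simplexStalkMap_degeneracyStalk θ p)

theorem fiberMap_fiberHom {Δ Δ' : SimplexCategoryᵒᵖ} (θ : Δ ⟶ Δ') {U : Opens X.obj} (p : X.obj)
    (hp : p ∈ U) (s : (X.obj.presheaf.obj (op U)).obj Δ) :
    X.fiberMap θ p (X.fiberHom Δ p hp s) =
      X.fiberHom Δ' p hp ((X.obj.presheaf.obj (op U)).map θ s) :=
  congrArg (LocAt.mk _ _) (X.simplexStalkMap_cgerm θ p hp s)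

/-- Families of elements of the localized stalks given by a section. -/
def sectionPredicate (Δ : SimplexCategoryᵒᵖ) :
    TopCat.PrelocalPredicate (X := X.obj.carrier) (X.Fiber Δ) where
  pred {U} σ := ∃ s : (X.obj.presheaf.obj (op U)).obj Δ, ∀ p : U, σ p = X.fiberHom Δ p.1 p.2 s
  res i σ := by
    rintro ⟨s, hs⟩
    exact ⟨(X.obj.presheaf.map i.op).app Δ s, fun p => (hs _).trans (X.fiberHom_res Δ i p.1 p.2 s).symm⟩

/-- The sections of the sheaf `O_n / 𝔱 O_n`. -/
def LocSec (Δ : SimplexCategoryᵒᵖ) (U : Opens X.obj) : Type u :=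
  {σ : ∀ p : U, X.Fiber Δ p.1 // (X.sectionPredicate Δ).sheafify.pred σ}

namespace LocSec

variable {X} {Δ Δ' : SimplexCategoryᵒᵖ} {U V : Opens X.obj}

theorem ext {σ τ : X.LocSec Δ U} (h : ∀ p : U, σ.1 p = τ.1 p) : σ = τ := Subtype.ext (funext h)

theorem exists_rep (σ : X.LocSec Δ U) {p : X.obj} (hp : p ∈ U) :
    ∃ (V : Opens X.obj) (i : V ⟶ U) (s : (X.obj.presheaf.obj (op V)).obj Δ), p ∈ V ∧
      ∀ (q : X.obj) (hq : q ∈ V), σ.1 ⟨q, i.le hq⟩ = X.fiberHom Δ q hq s := by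
  obtain ⟨V, hV, i, s, hs⟩ := σ.2 ⟨p, hp⟩
  exact ⟨V, i, s, hV, fun q hq => hs ⟨q, hq⟩⟩

theorem exists_reps {n : ℕ} (a : Fin n → X.LocSec Δ U) {p : X.obj} (hp : p ∈ U) :
    ∃ (V : Opens X.obj) (i : V ⟶ U) (s : Fin n → (X.obj.presheaf.obj (op V)).obj Δ), p ∈ V ∧
      ∀ (j : Fin n) (q : X.obj) (hq : q ∈ V), (a j).1 ⟨q, i.le hq⟩ = X.fiberHom Δ q hq (s j) := by
  choose V i s hV hs using fun j => exists_rep (a j) hp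
  let W : Opens X.obj := ⟨U ∩ ⋂ j, (V j : Set X.obj),
    U.isOpen.inter (isOpen_iInter_of_finite fun j => (V j).isOpen)⟩
  have hW : ∀ j, W ≤ V j := fun j =>
    Set.inter_subset_right.trans (Set.iInter_subset (fun j => (V j : Set X.obj)) j)
  exact ⟨W, homOfLE Set.inter_subset_left,
    fun j => (X.obj.presheaf.map (homOfLE (hW j)).op).app Δ (s j), ⟨hp, Set.mem_iInter.2 hV⟩,
    fun j q hq => (hs j q (hW j hq)).trans (X.fiberHom_res Δ (homOfLE (hW j)) q hq (s j)).symm⟩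

instance : CInftyRing (X.LocSec Δ U) := CInftyRing.ofOps
  { op := fun f a => ⟨fun p => CInftyRing.op f fun j => (a j).1 p, fun p => by
      obtain ⟨V, i, s, hV, hs⟩ := exists_reps a p.2
      refine ⟨V, hV, i, CInftyRing.op f s, fun q => ?_⟩
      rw [CInftyHom.op_apply]
      exact congrArg (CInftyRing.op (A := X.Fiber Δ q.1) f) (funext fun j => hs j q.1 q.2)⟩
    op_proj := fun _ _ => ext fun _ => CInftyRing.op_proj _ _
    op_comp := fun _ _ _ => ext fun _ => CInftyRing.op_comp _ _ _ }

/-- Evaluation at a point. -/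
def eval (p : U) : CInftyHom (X.LocSec Δ U) (X.Fiber Δ p.1) where
  toFun σ := σ.1 p
  map_op _ _ := rfl

/-- Restriction. -/
def restrict (i : V ⟶ U) : CInftyHom (X.LocSec Δ U) (X.LocSec Δ V) where
  toFun σ := ⟨fun p => σ.1 ⟨p.1, i.le p.2⟩, (X.sectionPredicate Δ).sheafify.res i σ.1 σ.2⟩
  map_op _ _ := rfl

/-- The maps induced by simplicial operators. -/
def map (θ : Δ ⟶ Δ') : CInftyHom (X.LocSec Δ U) (X.LocSec Δ' U) where
  toFun σ := ⟨fun p => X.fiberMap θ p.1 (σ.1 p), fun p => by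
    obtain ⟨V, i, s, hV, hs⟩ := exists_rep σ p.2
    refine ⟨V, hV, i, (X.obj.presheaf.obj (op V)).map θ s, fun q => ?_⟩
    exact (congrArg _ (hs q.1 q.2)).trans (X.fiberMap_fiberHom θ q.1 q.2 s)⟩
  map_op f a := ext fun p => (X.fiberMap θ p.1).op_apply f fun j => (a j).1 p

/-- The map from sections of `O_n`. -/
def ofSection : CInftyHom ((X.obj.presheaf.obj (op U)).obj Δ) (X.LocSec Δ U) where
  toFun s := ⟨fun p => X.fiberHom Δ p.1 p.2 s,
    (X.sectionPredicate Δ).sheafifyOf ⟨s, fun _ => rfl⟩⟩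
  map_op f a := ext fun p => (X.fiberHom Δ p.1 p.2).op_apply f a

theorem exists_ofSection_eq_restrict (σ : X.LocSec Δ U) {p : X.obj} (hp : p ∈ U) :
    ∃ (V : Opens X.obj) (i : V ⟶ U) (s : (X.obj.presheaf.obj (op V)).obj Δ), p ∈ V ∧
      ofSection s = restrict i σ := by
  obtain ⟨V, i, s, hV, hs⟩ := exists_rep σ hp
  exact ⟨V, i, s, hV, ext fun q => (hs q.1 q.2).symm⟩

end LocSec

/-- The sheaf `O_• / 𝔱 O_•`. -/
def locPresheaf : TopCat.Presheaf SCInftyRing.{u} X.obj.carrier where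
  obj U :=
    { obj Δ := ⟨X.LocSec Δ U.unop⟩
      map θ := LocSec.map θ
      map_id Δ := CInftyHom.hom_ext fun σ => LocSec.ext fun p => by
        obtain ⟨V, i, s, hV, hs⟩ := LocSec.exists_rep σ p.2
        refine (congrArg (X.fiberMap (𝟙 Δ) p.1) (hs p.1 hV)).trans
          (Eq.trans ?_ (hs p.1 hV).symm)
        rw [fiberMap_fiberHom, CategoryTheory.Functor.map_id]
        rfl
      map_comp θ θ' := CInftyHom.hom_ext fun σ => LocSec.ext fun p => by
        obtain ⟨V, i, s, hV, hs⟩ := LocSec.exists_rep σ p.2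
        refine (congrArg (X.fiberMap (θ ≫ θ') p.1) (hs p.1 hV)).trans
          (Eq.trans ?_ (congrArg (fun a => X.fiberMap θ' p.1 (X.fiberMap θ p.1 a))
            (hs p.1 hV)).symm)
        rw [fiberMap_fiberHom, fiberMap_fiberHom, fiberMap_fiberHom, Functor.map_comp]
        rfl }
  map i := { app Δ := LocSec.restrict i.unop }

/-- The space with presheaf `(X, O_• / 𝔱 O_•)`. -/
def locPresheafedSpace : PresheafedSpace.{u} SCInftyRing.{u} := ⟨X.obj.carrier, X.locPresheaf⟩

/-- The projection `O_• → O_• / 𝔱 O_•`. -/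
def locProj : X.locPresheafedSpace ⟶ X.obj where
  base := 𝟙 _
  c :=
    { app U :=
        { app Δ := LocSec.ofSection (U := U.unop)
          naturality Δ Δ' θ := CInftyHom.hom_ext fun s => LocSec.ext fun p =>
            (X.fiberMap_fiberHom θ p.1 p.2 s).symm }
      naturality U V i := by
        ext Δ s
        exact LocSec.ext fun p => X.fiberHom_res Δ i.unop p.1 p.2 s }

/-- The sections are the dependent functions that satisfy a local predicate, and such functions
glue. -/
theorem locPresheafedSpace_isSheaf (n : ℕ) :
    (levelPresheaf n X.locPresheafedSpace).sets.IsSheaf :=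
  TopCat.subpresheafToTypes.isSheaf (X.sectionPredicate (op ⦋n⦌)).sheafify

variable {X}

/-- A multiplier is the germ of a section, and an equality of germs holds on a neighbourhood; both
are realized on a common open set. -/
theorem fiberHom_eq_iff {Δ : SimplexCategoryᵒᵖ} {U : Opens X.obj} {p : X.obj} (hp : p ∈ U)
    {s s' : (X.obj.presheaf.obj (op U)).obj Δ} :
    X.fiberHom Δ p hp s = X.fiberHom Δ p hp s' ↔
      ∃ (W : Opens X.obj) (i : W ⟶ U) (b : (X.obj.presheaf.obj (op W)) _⦋0⦌) (hW : p ∈ W),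
        X.valueAt b p hW ≠ 0 ∧
        (X.obj.presheaf.obj (op W)).map (SimplexCategory.const Δ.unop ⦋0⦌ 0).op b *
          (X.obj.presheaf.map i.op).app Δ s =
        (X.obj.presheaf.obj (op W)).map (SimplexCategory.const Δ.unop ⦋0⦌ 0).op b *
          (X.obj.presheaf.map i.op).app Δ s' := by
  let θ : op ⦋0⦌ ⟶ Δ := (SimplexCategory.const Δ.unop ⦋0⦌ 0).op
  have hd : ∀ {W : Opens X.obj} (i : W ⟶ U) (b : (X.obj.presheaf.obj (op W)) _⦋0⦌) (hW : p ∈ W)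
      (s : (X.obj.presheaf.obj (op U)).obj Δ), (X.simplexPresheaf Δ).cgerm W p hW
        ((X.obj.presheaf.obj (op W)).map θ b * (X.obj.presheaf.map i.op).app Δ s) =
      X.degeneracyStalk Δ p ((levelPresheaf 0 X.obj).cgerm W p hW b) *
        (X.simplexPresheaf Δ).cgerm U p hp s := by
    intro W i b hW s
    rw [X.degeneracyStalk_cgerm Δ p hW b]
    refine ((X.simplexPresheaf Δ).cgerm_mul W p hW _ _).trans (congrArg _ ?_)
    exact (X.simplexPresheaf Δ).cgerm_res i p hW s
  refine Iff.trans LocAt.mk_eq_mk ⟨?_, ?_⟩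
  · rintro ⟨b, hb, h⟩
    obtain ⟨V, hV, b, rfl⟩ := (levelPresheaf 0 X.obj).exists_cgerm_eq b
    let W : Opens X.obj := U ⊓ V
    let i : W ⟶ U := homOfLE inf_le_left
    let j : W ⟶ V := homOfLE inf_le_right
    have hW : p ∈ W := ⟨hp, hV⟩
    have hbj : (levelPresheaf 0 X.obj).cgerm W p hW ((X.obj.presheaf.map j.op).app (op ⦋0⦌) b) =
      (levelPresheaf 0 X.obj).cgerm V p hV b := (levelPresheaf 0 X.obj).cgerm_res j p hW b
    obtain ⟨W', hW', k, l, hkl⟩ := TopCat.Presheaf.exists_res_eq_of_cgerm_eq _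
      ((hd i ((X.obj.presheaf.map j.op).app (op ⦋0⦌) b) hW s).trans
        (Eq.trans (by rw [hbj]; exact h)
          (hd i ((X.obj.presheaf.map j.op).app (op ⦋0⦌) b) hW s').symm))
    obtain rfl : k = l := Subsingleton.elim _ _
    refine ⟨W', k ≫ i, (X.obj.presheaf.map (k ≫ j).op).app (op ⦋0⦌) b, hW', ?_, ?_⟩
    · exact fun h0 => hb ((valueAt_res (k ≫ j) b p hW').symm.trans h0)
    · have e : ∀ s : (X.obj.presheaf.obj (op U)).obj Δ, (X.obj.presheaf.map k.op).app Δ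
          ((X.obj.presheaf.obj (op W)).map θ ((X.obj.presheaf.map j.op).app (op ⦋0⦌) b) *
            (X.obj.presheaf.map i.op).app Δ s) = (X.obj.presheaf.obj (op W')).map θ
              ((X.obj.presheaf.map (k ≫ j).op).app (op ⦋0⦌) b) *
            (X.obj.presheaf.map (k ≫ i).op).app Δ s := by
        intro s
        rw [CInftyHom.map_mul, op_comp, op_comp, Functor.map_comp, Functor.map_comp]
        exact congrArg (· * _) (ConcreteCategory.congr_hom ((X.obj.presheaf.map k.op).naturality θ)
          ((X.obj.presheaf.map j.op).app (op ⦋0⦌) b))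
      exact (e s).symm.trans (hkl.trans (e s'))
  · rintro ⟨W, i, b, hW, hb, h⟩
    refine ⟨(levelPresheaf 0 X.obj).cgerm W p hW b, hb, ?_⟩
    exact (hd i b hW s).symm.trans ((congrArg _ h).trans (hd i b hW s'))

/-- Local surjectivity is built into the sections. A multiplier $b$ that equalizes two sections does
not vanish at the point, so near it some $cb$ is homotopic to $1$, and $cb$ equalizes them too. -/
theorem locProj_isLocalQuotient : IsLocalQuotient X.locProj where
  isHomeomorph := IsHomeomorph.id
  surj n V t x hx := by
    obtain ⟨W, i, s, hW, hs⟩ := LocSec.exists_ofSection_eq_restrict (Δ := op ⦋n⦌) (U := V) t hx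
    exact ⟨W, i, s, hW, hs⟩
  ker n V s s' h x hx := by
    have h1 : X.fiberHom (op ⦋n⦌) x hx s = X.fiberHom (op ⦋n⦌) x hx s' :=
      congrArg (LocSec.eval (X := X) (Δ := op ⦋n⦌) (U := V) ⟨x, hx⟩) h
    obtain ⟨W, i, b, hW, hb, h2⟩ := (fiberHom_eq_iff hx).1 h1
    obtain ⟨W', j, c, z, hW', hz0, hz1⟩ := exists_homotopy_inverse b hW hb
    refine ⟨W', j ≫ i, z, hW', hz1, ?_⟩
    have h3 := congrArg ((X.obj.presheaf.map j.op).app (op ⦋n⦌)) h2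
    rw [CInftyHom.map_mul, CInftyHom.map_mul, IsLocalQuotient.app_res_res,
      IsLocalQuotient.app_res_res] at h3
    have h4 := IsLocalQuotient.app_degeneracy (X.obj.presheaf.map j.op) n b
    rw [hz0, CInftyHom.map_mul, mul_assoc, mul_assoc, ← h4]
    exact congrArg _ h3

end SCInftySpace

/-! ### The localized space and the ideal of trivial sections -/

namespace SCInftySpace

/-- Morphisms preserve values. -/
theorem valueAt_comp {X Y : SCInftySpace.{u}} (f : Y.obj ⟶ X.obj) {U : Opens X.obj}
    (b : (X.obj.presheaf.obj (op U)) _⦋0⦌) (y : Y.obj) (hy : f.base y ∈ U) :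
    Y.valueAt (U := (Opens.map f.base).obj U) ((f.c.app (op U)).app (op ⦋0⦌) b) y hy =
      X.valueAt b (f.base y) hy := by
  -- The residue map at `f y` may be replaced by the residue map at `y` composed with the map of
  -- $\pi_0$-stalks, since a local $C^\infty$-ring has only one morphism to $\mathbb R$.
  rw [valueAt_eq b, (X.property.isCInftySpace.isLocal (f.base y)).hom_ext
    (X.property.isCInftySpace.isLocal (f.base y)).residue
    ((Y.property.isCInftySpace.isLocal y).residue.comp (IsLocalQuotient.piZeroStalkMap f y))]
  refine (valueAt_eq _ y hy).trans (congrArg (Y.property.isCInftySpace.isLocal y).residue ?_)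
  exact (PresheafedSpace.cstalkMap_cgerm (IsLocalQuotient.piZeroMap f) y U hy
    (SCInftyRing.PiZero.mk (X.obj.presheaf.obj (op U)) b)).symm

variable (X : SCInftySpace.{u})

/-- The simplicial `C^∞`-space `(X, O_• / 𝔱 O_•)`. -/
def locSpace : SCInftySpace.{u} where
  obj := X.locPresheafedSpace
  property :=
    { isSheaf := X.locPresheafedSpace_isSheaf
      isCInftySpace := locProj_isLocalQuotient.isCInftySpace X.property.isCInftySpace }

/-- The projection `(X, O_• / 𝔱 O_•) → (X, O_•)`. -/
def locSpaceProj : X.locSpace ⟶ X := ObjectProperty.homMk X.locProj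

variable {X}

/-- A section that vanishes nowhere is invertible in `O_0 / 𝔱`. -/
theorem exists_ofSection_mul_eq_one {U : Opens X.obj} (b : (X.obj.presheaf.obj (op U)) _⦋0⦌)
    {p : X.obj} (hp : p ∈ U) (hb : X.valueAt b p hp ≠ 0) :
    ∃ (W : Opens X.obj) (i : W ⟶ U) (c : (X.obj.presheaf.obj (op U)) _⦋0⦌), p ∈ W ∧
      LocSec.restrict i (LocSec.ofSection (X := X) (Δ := op ⦋0⦌) (c * b)) = 1 := by
  obtain ⟨k, g, hk, hkg⟩ := SmoothFun.exists_local_inv hb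
  -- The set `W` is chosen so that $k(b)$ vanishes nowhere on it; then $g(b)\,b=1$ in every
  -- localized stalk over `W`, not only at `p`.
  obtain ⟨W, i, hW, h⟩ := exists_forall_valueAt_ne_zero (CInftyRing.op k ![b]) hp
    (by rw [valueAt_op]; exact hk)
  refine ⟨W, i, CInftyRing.op g ![b], hW, ?_⟩
  rw [← (LocSec.restrict i).map_one, ← LocSec.ofSection.map_one]
  refine LocSec.ext fun q => ?_
  refine (fiberHom_eq_iff (Δ := op ⦋0⦌) (i.le q.2)).2
    ⟨W, i, (X.obj.presheaf.map i.op).app (op ⦋0⦌) (CInftyRing.op k ![b]), q.2, ?_, ?_⟩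
  · rw [valueAt_res]
    exact h q.1 q.2
  · have h0 := SCInftyRing.degeneracy_zero (X.obj.presheaf.obj (op W))
      ((X.obj.presheaf.map i.op).app (op ⦋0⦌) (CInftyRing.op k ![b]))
    refine (congrArg (· * _) h0).trans (Eq.trans ?_ (congrArg (· * _) h0).symm)
    dsimp only
    rw [← CInftyHom.map_mul, ← CInftyHom.map_mul, CInftyRing.op_mul_inv hkg, mul_one]

/-- Every germ of the quotient lifts to a section `b` of $\mathcal O_0$. The projection preserves
values, so a non-zero value of the germ is one of `b`, whose image is then invertible near the
point. -/
theorem locSpace_isLocalized : isLocalized X.locSpace := by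
  intro (p : X.locSpace.obj)
  refine CInftyRing.isLocal_iff.2 ⟨X.locSpace.valueHom p, fun a ha => ?_⟩
  obtain ⟨U, hU, σ, rfl⟩ := (levelPresheaf 0 X.locSpace.obj).exists_cgerm_eq a
  obtain ⟨V, i, b, hV, hb⟩ := LocSec.exists_ofSection_eq_restrict (X := X) (Δ := op ⦋0⦌) (U := U)
    σ hU
  have h1 : (levelPresheaf 0 X.locSpace.obj).cgerm V p hV (LocSec.ofSection b) =
      (levelPresheaf 0 X.locSpace.obj).cgerm U p hU σ :=
    (congrArg _ hb).trans ((levelPresheaf 0 X.locSpace.obj).cgerm_res i p hV σ)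
  rw [← h1] at ha ⊢
  have h2 : X.valueAt b p hV ≠ 0 := fun h => ha ((valueAt_comp X.locSpaceProj.hom b p hV).trans h)
  obtain ⟨W, j, c, hW, h3⟩ := exists_ofSection_mul_eq_one b hV h2
  refine IsUnit.of_mul_eq_one ((levelPresheaf 0 X.locSpace.obj).cgerm V p hV
    (LocSec.ofSection c)) ?_
  rw [mul_comm]
  refine ((levelPresheaf 0 X.locSpace.obj).germHom V p hV).map_mul _ _ |>.symm.trans ?_
  refine ((levelPresheaf 0 X.locSpace.obj).cgerm_res j p hW _).symm.trans ?_
  refine Eq.trans (congrArg _ ?_) ((levelPresheaf 0 X.locSpace.obj).germHom W p hW).map_one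
  exact (congrArg (LocSec.restrict j) (LocSec.ofSection.map_mul c b).symm).trans h3

theorem fiberHom_degeneracy_eq_zero {n : ℕ} {U : Opens X.obj} {p : X.obj} (hp : p ∈ U)
    {α : (X.obj.presheaf.obj (op U)) _⦋0⦌} (hα : α ∈ X.trivialSections U) :
    X.fiberHom (op ⦋n⦌) p hp (SCInftyRing.degeneracy n _ α) = 0 := by
  obtain ⟨b, hb, h⟩ := (isTrivialGerm_iff _).1 (hα p hp)
  rw [← (LocAt.proj (X.degeneracyStalk (op ⦋n⦌) p) (X.valueHom p)).map_zero]
  refine LocAt.mk_eq_mk.2 ⟨b, hb, ?_⟩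
  refine (congrArg (_ * ·) (X.degeneracyStalk_cgerm (op ⦋n⦌) p hp α)).symm.trans ?_
  rw [← CInftyHom.map_mul, h, CInftyHom.map_zero, mul_zero]

theorem fiberHom_eq_zero_of_mem {n : ℕ} {U : Opens X.obj} {p : X.obj} (hp : p ∈ U)
    {s : (X.obj.presheaf.obj (op U)) _⦋n⦌} (hs : s ∈ X.trivialIdeal n U) :
    X.fiberHom (op ⦋n⦌) p hp s = 0 := by
  have h : X.trivialIdeal n U ≤ RingHom.ker (X.fiberHom (op ⦋n⦌) p hp).toRingHom := by
    refine Ideal.span_le.2 ?_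
    rintro _ ⟨α, hα, rfl⟩
    exact fiberHom_degeneracy_eq_zero hp hα
  exact h hs

/-- If $bs=0$ with $b$ non-zero at $p$, put $\alpha=1-g(b)\,b$. Then $s=s\alpha$ and
$k(b)\,\alpha=0$. Triviality of $\alpha$ is required at every point of the neighbourhood, which is
therefore shrunk until $k(b)$ vanishes nowhere on it. -/
theorem exists_res_mem_trivialIdeal {n : ℕ} {U : Opens X.obj} {p : X.obj} (hp : p ∈ U)
    {s : (X.obj.presheaf.obj (op U)) _⦋n⦌} (hs : X.fiberHom (op ⦋n⦌) p hp s = 0) :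
    ∃ (V : Opens X.obj) (i : V ⟶ U) (_ : p ∈ V),
      (levelPresheaf n X.obj).map i.op s ∈ X.trivialIdeal n V := by
  rw [← (X.fiberHom (op ⦋n⦌) p hp).map_zero] at hs
  obtain ⟨W, i, b, hW, hb, h⟩ := (fiberHom_eq_iff hp).1 hs
  obtain ⟨k, g, hk, hkg⟩ := SmoothFun.exists_local_inv hb
  obtain ⟨V, j, hV, hk'⟩ := exists_forall_valueAt_ne_zero (CInftyRing.op k ![b]) hW
    (by rw [valueAt_op]; exact hk)
  let b' : (X.obj.presheaf.obj (op V)) _⦋0⦌ := (X.obj.presheaf.map j.op).app (op ⦋0⦌) b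
  let α : (X.obj.presheaf.obj (op V)) _⦋0⦌ := 1 - CInftyRing.op g ![b'] * b'
  have hα : α ∈ X.trivialSections V := by
    intro q hq
    refine (isTrivialGerm_iff _).2
      ⟨(levelPresheaf 0 X.obj).cgerm V q hq (CInftyRing.op k ![b']), ?_, ?_⟩
    · have h1 := hk' q hq
      rw [valueAt_op, ← valueAt_res j b q hq, ← valueAt_op] at h1
      exact h1
    · refine ((levelPresheaf 0 X.obj).germHom V q hq).map_mul _ _ |>.symm.trans ?_
      have : CInftyRing.op k ![b'] * α = 0 := by
        rw [mul_sub, CInftyRing.op_mul_inv hkg, mul_one, sub_self]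
      exact (congrArg _ this).trans ((levelPresheaf 0 X.obj).cgerm_zero V q hq)
  refine ⟨V, j ≫ i, hV, ?_⟩
  let s' : (X.obj.presheaf.obj (op V)) _⦋n⦌ := (X.obj.presheaf.map (j ≫ i).op).app (op ⦋n⦌) s
  have hbs : SCInftyRing.degeneracy n _ b' * s' = 0 := by
    have h1 := congrArg ((X.obj.presheaf.map j.op).app (op ⦋n⦌)) h
    rw [CInftyHom.map_zero, mul_zero, CInftyHom.map_zero, CInftyHom.map_mul,
      IsLocalQuotient.app_res_res] at h1
    have h2 := IsLocalQuotient.app_degeneracy (X.obj.presheaf.map j.op) n b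
    exact (congrArg (· * s') h2).symm.trans h1
  have hs' : s' = s' * SCInftyRing.degeneracy n _ α := by
    rw [mul_comm, CInftyHom.map_sub, CInftyHom.map_one, CInftyHom.map_mul, sub_mul, one_mul, mul_assoc, hbs,
      mul_zero, sub_zero]
  have hmem : s' * SCInftyRing.degeneracy n _ α ∈ X.trivialIdeal n V :=
    Ideal.mul_mem_left (X.trivialIdeal n V) s' (Ideal.subset_span ⟨α, hα, rfl⟩)
  rw [← hs'] at hmem
  exact hmem

theorem locSpaceProj_isQuotientByTrivialSections :
    IsQuotientByTrivialSections X.locSpaceProj where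
  isHomeomorph := IsHomeomorph.id
  locallySurjective n U t x hx := by
    obtain ⟨W, i, s, hW, hs⟩ := locProj_isLocalQuotient.surj n U t x hx
    exact ⟨W, i, hW, s, hs⟩
  ker n U s := by
    constructor
    · intro h x hx
      exact exists_res_mem_trivialIdeal hx
        ((congrArg (LocSec.eval (X := X) (Δ := op ⦋n⦌) (U := U) ⟨x, hx⟩) h).trans
          (CInftyHom.map_zero _))
    · intro h
      refine LocSec.ext (X := X) (Δ := op ⦋n⦌) (U := U) fun x => ?_
      obtain ⟨V, i, hV, hs⟩ := h x.1 x.2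
      exact (X.fiberHom_res (op ⦋n⦌) i x.1 hV s).symm.trans ((fiberHom_eq_zero_of_mem hV hs).trans
        (LocSec.eval (X := X) (Δ := op ⦋n⦌) (U := U) x).map_zero.symm)

/-! ### The universal property -/

section Lift

variable {Y : SCInftySpace.{u}} (f : Y.obj ⟶ X.obj)

/-- The map on stalks of `O_n` induced by a morphism. -/
def stalkHom (Δ : SimplexCategoryᵒᵖ) (y : Y.obj) :
    CInftyHom ((X.simplexPresheaf Δ).CStalk (f.base y)) ((Y.simplexPresheaf Δ).CStalk y) :=
  PresheafedSpace.cstalkMap (Y := ⟨Y.obj.carrier, Y.simplexPresheaf Δ⟩)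
    (X := ⟨X.obj.carrier, X.simplexPresheaf Δ⟩)
    (((evaluation SimplexCategoryᵒᵖ CInftyRingCat.{u}).obj Δ).mapPresheaf.map f) y

theorem stalkHom_cgerm (Δ : SimplexCategoryᵒᵖ) (y : Y.obj) {U : Opens X.obj} (hy : f.base y ∈ U)
    (s : (X.obj.presheaf.obj (op U)).obj Δ) :
    stalkHom f Δ y ((X.simplexPresheaf Δ).cgerm U (f.base y) hy s) =
      (Y.simplexPresheaf Δ).cgerm ((Opens.map f.base).obj U) y hy ((f.c.app (op U)).app Δ s) :=
  PresheafedSpace.cstalkMap_cgerm (Y := ⟨Y.obj.carrier, Y.simplexPresheaf Δ⟩)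
    (X := ⟨X.obj.carrier, X.simplexPresheaf Δ⟩)
    (((evaluation SimplexCategoryᵒᵖ CInftyRingCat.{u}).obj Δ).mapPresheaf.map f) y U hy s

variable (hY : isLocalized Y)
include hY

/-- Values are preserved, so the image of `b` in the stalk of $\mathcal O_{0,Y}$ has non-zero value
and is a unit there, `Y` being localized. The degeneracies carry it to a unit in every level. -/
theorem isUnit_stalkHom (Δ : SimplexCategoryᵒᵖ) (y : Y.obj)
    (b : (levelPresheaf 0 X.obj).CStalk (f.base y)) (hb : X.valueHom (f.base y) b ≠ 0) :
    IsUnit (stalkHom f Δ y (X.degeneracyStalk Δ (f.base y) b)) := by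
  obtain ⟨U, hU, b, rfl⟩ := (levelPresheaf 0 X.obj).exists_cgerm_eq b
  have h1 : IsUnit ((levelPresheaf 0 Y.obj).cgerm ((Opens.map f.base).obj U) y hU
      ((f.c.app (op U)).app (op ⦋0⦌) b)) :=
    (hY y).isUnit_of_ne_zero (Y.valueHom y) fun h => hb ((valueAt_comp f b y hU).symm.trans h)
  have h2 := (Y.degeneracyStalk Δ y).isUnit_map h1
  have h3 : stalkHom f Δ y (X.degeneracyStalk Δ (f.base y)
      ((levelPresheaf 0 X.obj).cgerm U (f.base y) hU b)) = Y.degeneracyStalk Δ y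
        ((levelPresheaf 0 Y.obj).cgerm ((Opens.map f.base).obj U) y hU
          ((f.c.app (op U)).app (op ⦋0⦌) b)) := by
    refine (congrArg (stalkHom f Δ y) (X.degeneracyStalk_cgerm Δ (f.base y) hU b)).trans ?_
    refine (stalkHom_cgerm f Δ y hU _).trans ?_
    refine Eq.trans (congrArg _ ?_) (Y.degeneracyStalk_cgerm Δ (U := (Opens.map f.base).obj U) y hU
      ((f.c.app (op U)).app (op ⦋0⦌) b)).symm
    exact ConcreteCategory.congr_hom ((f.c.app (op U)).naturality
      (SimplexCategory.const Δ.unop ⦋0⦌ 0).op) b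
  rw [h3]
  exact h2

/-- The map from the localized stalks of `O_n`. -/
def fiberLift (Δ : SimplexCategoryᵒᵖ) (y : Y.obj) :
    CInftyHom (X.Fiber Δ (f.base y)) ((Y.simplexPresheaf Δ).CStalk y) :=
  LocAt.lift (stalkHom f Δ y) (isUnit_stalkHom f hY Δ y)

theorem fiberLift_fiberHom (Δ : SimplexCategoryᵒᵖ) (y : Y.obj) {U : Opens X.obj}
    (hy : f.base y ∈ U) (s : (X.obj.presheaf.obj (op U)).obj Δ) :
    fiberLift f hY Δ y (X.fiberHom Δ (f.base y) hy s) =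
      (Y.simplexPresheaf Δ).cgerm ((Opens.map f.base).obj U) y hy ((f.c.app (op U)).app Δ s) :=
  stalkHom_cgerm f Δ y hy s

/-- Where `σ` is given by a section `s` of $\mathcal O_{n,X}$, the prescribed germs are those of the
image of `s`; hence they glue in the sheaf $\mathcal O_{n,Y}$. -/
theorem exists_lift {Δ : SimplexCategoryᵒᵖ} {U : Opens X.obj} (σ : X.LocSec Δ U) :
    ∃ t : (Y.obj.presheaf.obj (op ((Opens.map f.base).obj U))).obj Δ,
      ∀ (y : Y.obj) (hy : f.base y ∈ U), (Y.simplexPresheaf Δ).cgerm ((Opens.map f.base).obj U) y hy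
        t = fiberLift f hY Δ y (σ.1 ⟨f.base y, hy⟩) := by
  refine TopCat.Presheaf.exists_section (F := Y.simplexPresheaf Δ)
    (Y.property.isSheaf Δ.unop.len) (U := (Opens.map f.base).obj U)
    (fun y hy => fiberLift f hY Δ y (σ.1 ⟨f.base y, hy⟩)) fun y hy => ?_
  obtain ⟨V, i, s, hV, hs⟩ := LocSec.exists_rep σ hy
  refine ⟨(Opens.map f.base).obj V, hV, fun z hz => i.le hz, (f.c.app (op V)).app Δ s,
    fun z hz hzU => ?_⟩
  exact (congrArg (fiberLift f hY Δ z) (hs _ hz)).trans (fiberLift_fiberHom f hY Δ z hz s)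

/-- The map from sections of `O_n / 𝔱 O_n`. -/
def liftHom (Δ : SimplexCategoryᵒᵖ) (U : Opens X.obj) : CInftyHom (X.LocSec Δ U)
    ((Y.obj.presheaf.obj (op ((Opens.map f.base).obj U))).obj Δ) where
  toFun σ := (exists_lift f hY σ).choose
  map_op k a := by
    refine TopCat.Presheaf.cgerm_ext (F := Y.simplexPresheaf Δ) (Y.property.isSheaf Δ.unop.len)
      (U := (Opens.map f.base).obj U) fun y hy => ?_
    refine ((exists_lift f hY _).choose_spec y hy).trans
      (((fiberLift f hY Δ y).op_apply k fun j => (a j).1 ⟨f.base y, hy⟩).trans ?_)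
    refine Eq.trans (congrArg _ (funext fun j => ?_)) (TopCat.Presheaf.cgerm_op _ _ _ _ _ _).symm
    exact ((exists_lift f hY (a j)).choose_spec y hy).symm

/-- The germ of the lift at `y` can be computed from any representative at `f y`. This reduces
naturality and both inverse laws to statements about sections of $\mathcal O_{n,X}$. -/
theorem cgerm_liftHom {Δ : SimplexCategoryᵒᵖ} {U : Opens X.obj} (σ : X.LocSec Δ U) {y : Y.obj}
    (hy : f.base y ∈ U) {V : Opens X.obj} (hV : f.base y ∈ V)
    {s : (X.obj.presheaf.obj (op V)).obj Δ}
    (h : σ.1 ⟨f.base y, hy⟩ = X.fiberHom Δ (f.base y) hV s) :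
    (Y.simplexPresheaf Δ).cgerm ((Opens.map f.base).obj U) y hy (liftHom f hY Δ U σ) =
      (Y.simplexPresheaf Δ).cgerm ((Opens.map f.base).obj V) y hV ((f.c.app (op V)).app Δ s) := by
  refine ((exists_lift f hY σ).choose_spec y hy).trans ?_
  rw [h]
  exact fiberLift_fiberHom f hY Δ y hV s

/-- The factorization of a morphism from a localized space through `(X, O_• / 𝔱 O_•)`. -/
def locLift : Y.obj ⟶ X.locPresheafedSpace where
  base := f.base
  c :=
    { app U :=
        { app Δ := liftHom f hY Δ U.unop
          naturality Δ Δ' θ := CInftyHom.hom_ext fun σ => by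
            refine TopCat.Presheaf.cgerm_ext (F := Y.simplexPresheaf Δ')
              (Y.property.isSheaf Δ'.unop.len) (U := (Opens.map f.base).obj U.unop) fun y hy => ?_
            obtain ⟨V, i, s, hV, hs⟩ := LocSec.exists_rep (X := X) (Δ := Δ) (U := U.unop) σ hy
            refine (cgerm_liftHom f hY (LocSec.map θ σ) hy hV ((congrArg (X.fiberMap θ _)
              (hs _ hV)).trans (X.fiberMap_fiberHom θ _ hV s))).trans ?_
            have h1 := cgerm_liftHom f hY σ hy hV (hs _ hV)
            have h2 := congrArg (Y.simplexStalkMap θ y) h1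
            refine Eq.trans ?_ ((Y.simplexStalkMap_cgerm θ y (U := (Opens.map f.base).obj V) hV
              _).symm.trans (h2.symm.trans
                (Y.simplexStalkMap_cgerm θ y (U := (Opens.map f.base).obj U.unop) hy _)))
            exact congrArg _ (ConcreteCategory.congr_hom ((f.c.app (op V)).naturality θ) s) }
      naturality U U' j := by
        ext Δ σ
        refine TopCat.Presheaf.cgerm_ext (F := Y.simplexPresheaf Δ)
          (Y.property.isSheaf Δ.unop.len) (U := (Opens.map f.base).obj U'.unop) fun y hy => ?_
        obtain ⟨V, i, s, hV, hs⟩ := LocSec.exists_rep (X := X) (Δ := Δ) (U := U.unop) σ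
          (j.unop.le hy)
        refine (cgerm_liftHom f hY (LocSec.restrict j.unop σ) hy hV (hs _ hV)).trans ?_
        refine (cgerm_liftHom f hY σ (j.unop.le hy) hV (hs _ hV)).symm.trans ?_
        exact ((Y.simplexPresheaf Δ).cgerm_res ((Opens.map f.base).map j.unop) y hy
          (liftHom f hY Δ U.unop σ)).symm }

theorem locLift_comp_locProj : locLift f hY ≫ X.locProj = f := by
  refine PresheafedSpace.hext _ _ rfl (heq_of_eq ?_)
  ext U Δ s
  refine TopCat.Presheaf.cgerm_ext (F := Y.simplexPresheaf Δ)
    (Y.property.isSheaf Δ.unop.len) (U := (Opens.map f.base).obj U) fun y hy => ?_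
  exact cgerm_liftHom f hY (LocSec.ofSection s) hy hy rfl

/-- Sections of the quotient are locally images of sections of $\mathcal O_{n,X}$, so `k` is
determined by its composite with the projection. -/
theorem locLift_comp (k : Y.obj ⟶ X.locPresheafedSpace) : locLift (k ≫ X.locProj) hY = k := by
  refine PresheafedSpace.hext _ _ rfl (heq_of_eq ?_)
  ext U Δ σ
  refine TopCat.Presheaf.cgerm_ext (F := Y.simplexPresheaf Δ)
    (Y.property.isSheaf Δ.unop.len) (U := (Opens.map k.base).obj U) fun y hy => ?_
  obtain ⟨V, i, s, hV, hs⟩ := LocSec.exists_rep (X := X) (Δ := Δ) (U := U) σ hy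
  refine (cgerm_liftHom (k ≫ X.locProj) hY σ hy hV (hs _ hV)).trans ?_
  have h1 : LocSec.ofSection s = LocSec.restrict i σ := LocSec.ext fun q => (hs q.1 q.2).symm
  refine Eq.trans (congrArg (fun τ => (Y.simplexPresheaf Δ).cgerm ((Opens.map k.base).obj V) y hV
    ((k.c.app (op V)).app Δ τ)) h1) ?_
  refine Eq.trans (congrArg _ (ConcreteCategory.congr_hom
    (congr_app (k.c.naturality i.op) Δ) σ)) ?_
  exact (Y.simplexPresheaf Δ).cgerm_res ((Opens.map k.base).map i) y hV _

end Lift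

/-- The localization of a simplicial `C^∞`-space. -/
def localization (X : SCInftySpace.{u}) : LocalizedSCInftySpace.{u} :=
  ⟨X.locSpace, locSpace_isLocalized⟩

/-- Morphisms from a localized space factor uniquely through the localization. -/
def homEquivLocalization (Y : LocalizedSCInftySpace.{u}) (X : SCInftySpace.{u}) :
    (isLocalized.{u}.ι.obj Y ⟶ X) ≃ (Y ⟶ X.localization) where
  toFun f := ObjectProperty.homMk (ObjectProperty.homMk (locLift f.hom Y.property))
  invFun g := g.hom ≫ X.locSpaceProj
  left_inv f := ObjectProperty.hom_ext _ (locLift_comp_locProj f.hom Y.property)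
  right_inv g := ObjectProperty.hom_ext _ (ObjectProperty.hom_ext _
    (locLift_comp Y.property g.hom.hom))

end SCInftySpace

end

/-! ### The adjunction -/

/-- The inclusion of the localized simplicial `C^∞`-spaces into all simplicial `C^∞`-spaces has a
right adjoint, which sends `(X, O_•)` to `(X, O_• / 𝔱 O_•)` with `𝔱` the sheaf of trivial sections.
The unit is an isomorphism and the counit consists of local weak equivalences. -/
theorem mainTheorem3 :
    ∃ (R : SCInftySpace.{u} ⥤ LocalizedSCInftySpace.{u}) (adj : isLocalized.{u}.ι ⊣ R),
      IsIso adj.unit ∧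
      (∀ X : SCInftySpace.{u}, IsLocalWeakEquivalence (adj.counit.app X)) ∧
      (∀ X : SCInftySpace.{u}, IsQuotientByTrivialSections (adj.counit.app X)) := by
  have he : ∀ (Y' Y : LocalizedSCInftySpace.{u}) (X : SCInftySpace.{u}) (f : Y' ⟶ Y)
      (g : isLocalized.{u}.ι.obj Y ⟶ X),
      SCInftySpace.homEquivLocalization Y' X (isLocalized.{u}.ι.map f ≫ g) =
        f ≫ SCInftySpace.homEquivLocalization Y X g := by
    intro Y' Y X f g
    -- The inverse bijection is composition with the projection, and for it naturality is
    -- associativity.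
    rw [← Equiv.eq_symm_apply]
    refine Eq.trans ?_ (Category.assoc f.hom (SCInftySpace.homEquivLocalization Y X g).hom
      X.locSpaceProj).symm
    exact congrArg (f.hom ≫ ·) ((SCInftySpace.homEquivLocalization Y X).symm_apply_apply g).symm
  let adj := Adjunction.adjunctionOfEquivRight SCInftySpace.homEquivLocalization he
  -- The counit corresponds to the identity under the bijection, so it is the projection.
  have hc : ∀ X, adj.counit.app X = X.locSpaceProj := fun X =>
    (adj.homEquiv_symm_id X).symm.trans (Category.id_comp X.locSpaceProj)
  -- The unit is invertible because the left adjoint is the inclusion of a full subcategory, hence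
  -- fully faithful.
  refine ⟨_, adj, inferInstance, fun X => ?_, fun X => ?_⟩
  · rw [hc]
    exact SCInftySpace.locProj_isLocalQuotient.isLocalWeakEquivalence (f := X.locSpaceProj)
  · rw [hc]
    exact SCInftySpace.locSpaceProj_isQuotientByTrivialSections
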